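/- Let $n\in\mathbb N$ and $s>1$. A function $f\in C^\infty(\mathbb R^{2n};\mathbb C)$ belongs to $\mathcal G^s_b(\mathbb R^{2n})$ if there is $C>0$ with $$|\partial_x^\alpha\partial_\theta^\beta f(x,\theta)|\le C^{1+|\alpha|+|\beta|}\,\alpha!^s\,\beta!^s\qquad\text{for all }\alpha,\beta\in\mathbb N^n,\ (x,\theta)\in\mathbb R^{2n}.$$ A family $f(\cdot;h)$, $h\in(0,1]$, of such functions is said to belong to $\mathcal G^s_b(\mathbb R^{2n})$ uniformly in $h$ if these estimates hold with one constant $C$ for all $h\in(0,1]$. For $f\in\mathcal G^s_b(\mathbb R^{2n})$ (possibly depending on $h$) and $u\in\mathscr S(\mathbb R^n)$ the semiclassical Weyl quantization is $$f^w(x,hD)u(x)=\frac1{(2\pi h)^n}\int_{\mathbb R^n}\Big(\int_{\mathbb R^n}e^{\frac ih(x-y)\cdot\theta}f\big(\tfrac{x+y}2,\theta\big)u(y)\,dy\Big)d\theta .$$ **Proposition.** Let $a,b\in\mathcal G^s_b(\mathbb R^{2n})$ be independent of $h$. Then: 1. There is a family $c(\cdot;h)$, $h\in(0,1]$, belonging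 to $\mathcal G^s_b(\mathbb R^{2n})$ uniformly in $h$, such that $c^w(x,hD;h)=a^w(x,hD)\circ b^w(x,hD)$ on $\mathscr S(\mathbb R^n)$ for every $h\in(0,1]$. 2. Whenever $c(\cdot;h)$, $h\in(0,1]$, is a family with $c(\cdot;h)\in\mathcal G^s_b(\mathbb R^{2n})$ for each $h$ and $c^w(x,hD;h)=a^w(x,hD)\circ b^w(x,hD)$ on $\mathscr S(\mathbb R^n)$ for every $h\in(0,1]$, there is a family $r(\cdot;h)$ belonging to $\mathcal G^s_b(\mathbb R^{2n})$ uniformly in $h\in(0,1]$ such that $$c(x,\theta;h)=a(x,\theta)\,b(x,\theta)+h\,r(x,\theta;h),\qquad (x,\theta)\in\mathbb R^{2n},\ h\in(0,1].$$ -/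

import Mathlib

open MeasureTheory
open scoped SchwartzMap ContDiff

namespace GevreyWeyl

/-- The configuration space `ℝⁿ` with its Euclidean structure. -/
abbrev Config (n : ℕ) : Type := EuclideanSpace ℝ (Fin n)

/-- The phase space `ℝ²ⁿ = ℝⁿ × ℝⁿ`, with points `(x, θ)`. -/
abbrev PhaseSpace (n : ℕ) : Type := Config n × Config n

/-- The derivative of `f` in the constant direction `v`. -/
noncomputable def dirDeriv {n : ℕ} (v : PhaseSpace n) (f : PhaseSpace n → ℂ) :
    PhaseSpace n → ℂ :=
  fun p => fderiv ℝ f p v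

/-- `v₁^{α₁} ⋯ vₙ^{αₙ} f`, where the vector `vᵢ` acts as a directional derivative. -/
noncomputable def iterDeriv {n : ℕ} (v : Fin n → PhaseSpace n) (α : Fin n → ℕ)
    (f : PhaseSpace n → ℂ) : PhaseSpace n → ℂ :=
  (List.finRange n).foldr (fun i g => (dirDeriv (v i))^[α i] g) f

/-- The partial derivative `∂_x^α` with multi-index `α ∈ ℕⁿ`. -/
noncomputable def partialX {n : ℕ} (α : Fin n → ℕ) (f : PhaseSpace n → ℂ) :
    PhaseSpace n → ℂ :=
  iterDeriv (fun i => (EuclideanSpace.single i (1 : ℝ), 0)) α f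

/-- The partial derivative `∂_θ^β` with multi-index `β ∈ ℕⁿ`. -/
noncomputable def partialTheta {n : ℕ} (β : Fin n → ℕ) (f : PhaseSpace n → ℂ) :
    PhaseSpace n → ℂ :=
  iterDeriv (fun i => (0, EuclideanSpace.single i (1 : ℝ))) β f

/-- The order `|α| = α₁ + ⋯ + αₙ` of a multi-index. -/
def multiOrder {n : ℕ} (α : Fin n → ℕ) : ℕ := ∑ i, α i

/-- The factorial `α! = α₁! ⋯ αₙ!` of a multi-index. -/
def multiFactorial {n : ℕ} (α : Fin n → ℕ) : ℕ := ∏ i, (α i).factorial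

/-- `f` is smooth on `ℝ²ⁿ` and satisfies the global Gevrey-`s` estimates with constant `C`:
`|∂_x^α ∂_θ^β f(x,θ)| ≤ C^{1+|α|+|β|} α!^s β!^s` for all `α, β` and all `(x,θ)`. -/
def GevreyBound {n : ℕ} (s C : ℝ) (f : PhaseSpace n → ℂ) : Prop :=
  ContDiff ℝ ∞ f ∧
    ∀ (α β : Fin n → ℕ) (p : PhaseSpace n),
      ‖partialX α (partialTheta β f) p‖ ≤
        C ^ (1 + multiOrder α + multiOrder β) *
          ((multiFactorial α : ℝ) ^ s * (multiFactorial β : ℝ) ^ s)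

/-- The bounded (global) Gevrey class `𝒢ˢ_b(ℝ²ⁿ)` of functions. -/
def IsGevrey {n : ℕ} (s : ℝ) (f : PhaseSpace n → ℂ) : Prop :=
  ∃ C : ℝ, 0 < C ∧ GevreyBound s C f

/-- An `h`-dependent Gevrey symbol `f(·;h) ∈ 𝒢ˢ_b(ℝ²ⁿ)`, `h ∈ (0,1]`: the Gevrey estimates hold
with one constant `C` for all `h ∈ (0,1]`. -/
def IsGevreySymbol {n : ℕ} (s : ℝ) (f : ℝ → PhaseSpace n → ℂ) : Prop :=
  ∃ C : ℝ, 0 < C ∧ ∀ h ∈ Set.Ioc (0 : ℝ) 1, GevreyBound s C (f h)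

/-- The semiclassical Weyl quantization
`a^w(x,hD) u(x) = (2πh)^{-n} ∬ e^{i (x-y)·θ / h} a((x+y)/2, θ) u(y) dy dθ`.
As usual the oscillatory integral is evaluated by integrating in `y` first: when all derivatives of
`a` are bounded and `u` is a Schwartz function, the `y`-integral converges absolutely and, on
integrating by parts in `y`, is seen to decay rapidly in `θ`. -/
noncomputable def weyl {n : ℕ} (h : ℝ) (a : PhaseSpace n → ℂ) (u : Config n → ℂ) :
    Config n → ℂ :=
  fun x => (((2 * Real.pi * h) ^ n)⁻¹ : ℝ) *
    ∫ θ : Config n, ∫ y : Config n,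
      Complex.exp (Complex.I * ((inner ℝ (x - y) θ / h : ℝ) : ℂ)) *
        a ((2⁻¹ : ℝ) • (x + y), θ) * u y

/-- `c(·;h)` is a Weyl symbol of the composed operator: for all `h ∈ (0,1]`,
`c^w(x,hD;h) = a^w(x,hD) ∘ b^w(x,hD)` as operators on the Schwartz space `𝒮(ℝⁿ)`. -/
def IsComposedSymbol {n : ℕ} (a b : PhaseSpace n → ℂ) (c : ℝ → PhaseSpace n → ℂ) : Prop :=
  ∀ h ∈ Set.Ioc (0 : ℝ) 1, ∀ u : 𝓢(Config n, ℂ),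
    weyl h (c h) u = weyl h a (weyl h b u)

end GevreyWeyl

/-! The composed symbol is the Moyal product. For Schwartz `a` it is (a ⋆ b)(z) = ∫ â(ζ) e^{2πi ζ·z}
b(z + hσζ) dζ, with σ(p, q) = (πq, -πp). For symbols with merely bounded derivatives this integral
need not converge absolutely. `pairing` gives it a meaning by cutting `a` into unit-size pieces and
summing their contributions, which decay in the position of the piece.

Three properties of ⋆ carry the proof. It is a bounded bilinear form evaluated at simultaneous
translates of both factors, so directional derivatives obey the Leibniz rule (`fderiv_star`). It is
bounded by a fixed finite number of derivatives of the factors, uniformly for 0 ≤ h ≤ 1. Finally, a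
⋆ b - ab is O(h) in the same norms: putting b(z) in place of b(z + hσζ) gives exactly a(z)b(z), and
the difference is O(h(1 + |ζ|)) together with its derivatives (`exists_norm_star_le`).

Any product with the first two properties preserves Gevrey regularity, with a constant depending
only on its bounds (`LeibnizProduct.exists_listGevrey`): the Leibniz rule produces 2^k terms for k
derivatives, the factorials of a splitting multiply to at most the full factorial, and a fixed loss
of derivatives costs only a geometric factor. Applied to ⋆ this gives `c`; applied to (a ⋆ b - ab)/h
it gives `r`, both uniformly in `h`.

The operator identity is proved for compactly supported `a`, where Fourier inversion writes a^w as a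
superposition of Heisenberg translations (`weyl_superposition`). Cutoffs and dominated convergence
extend it to bounded `a` (`weyl_star`). Injectivity of quantization (`eq_zero_of_weyl_eq_zero`)
identifies every admissible symbol of the composition with a ⋆ b. -/

namespace GevreyWeyl

/-! ### Weighted bounds on derivatives -/

section Calculus

open Filter Topology

section Decay

variable {E : Type*} [NormedAddCommGroup E]

/-- The weight `(1 + ‖y‖)^{-r}`. -/
noncomputable def decay (r : ℕ) (y : E) : ℝ := ((1 + ‖y‖) ^ r)⁻¹

lemma decay_pos (r : ℕ) (y : E) : 0 < decay r y := by
  unfold decay; positivity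

@[simp] lemma decay_zero (y : E) : decay 0 y = 1 := by simp [decay]

lemma decay_add (r s : ℕ) (y : E) : decay (r + s) y = decay r y * decay s y := by
  simp [decay, pow_add, mul_comm]

/-- Peetre's inequality; it lets weights follow translations of the functions. -/
lemma decay_translate (r : ℕ) (y v : E) : decay r (y + v) ≤ (1 + ‖v‖) ^ r * decay r y := by
  unfold decay
  rw [← div_eq_mul_inv, le_div_iff₀ (by positivity), inv_mul_le_iff₀ (by positivity), ← mul_pow]
  gcongr
  have : ‖y‖ ≤ ‖y + v‖ + ‖v‖ := by simpa using norm_sub_le (y + v) v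
  nlinarith [norm_nonneg (y + v), norm_nonneg v, mul_nonneg (norm_nonneg (y + v)) (norm_nonneg v)]

end Decay

variable {E : Type*} [NormedAddCommGroup E] [NormedSpace ℝ E]
  {G : Type*} [NormedAddCommGroup G] [NormedSpace ℝ G]

/-- All derivatives of `f` of order at most `N` are bounded by the weight `w`. -/
def HasBound (N : ℕ) (w : E → ℝ) (f : E → ℂ) : Prop :=
  ∀ p ≤ N, ∀ y, ‖iteratedFDeriv ℝ p f y‖ ≤ w y

/-- Smooth functions all of whose derivatives are `O((1 + ‖y‖)^{-r})`. -/
def Nice (r : ℕ) (f : E → ℂ) : Prop :=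
  ContDiff ℝ ∞ f ∧ ∀ N, ∃ M : ℝ, 0 ≤ M ∧ HasBound N (fun y => M * decay r y) f

namespace HasBound

variable {N : ℕ} {w w' : E → ℝ} {f g : E → ℂ}

lemma mono (h : HasBound N w f) {N' : ℕ} (hN : N' ≤ N) (hw : ∀ y, w y ≤ w' y) :
    HasBound N' w' f :=
  fun p hp y => (h p (hp.trans hN) y).trans (hw y)

lemma norm_le (h : HasBound N w f) (y : E) : ‖f y‖ ≤ w y := by
  simpa using h 0 (Nat.zero_le _) y

lemma nonneg (h : HasBound N w f) (y : E) : 0 ≤ w y := (norm_nonneg _).trans (h.norm_le y)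

lemma add (hf : ContDiff ℝ ∞ f) (hg : ContDiff ℝ ∞ g) (h : HasBound N w f)
    (h' : HasBound N w' g) : HasBound N (fun y => w y + w' y) (fun y => f y + g y) := by
  intro p hp y
  have e := iteratedFDeriv_add_apply (i := p) (x := y)
    ((hf.of_le (by exact_mod_cast le_top)).contDiffAt)
    ((hg.of_le (by exact_mod_cast le_top)).contDiffAt)
  change ‖iteratedFDeriv ℝ p (f + g) y‖ ≤ _
  rw [e]
  exact (norm_add_le _ _).trans (add_le_add (h p hp y) (h' p hp y))

lemma const_smul (hf : ContDiff ℝ ∞ f) (h : HasBound N w f) (t : ℂ) :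
    HasBound N (fun y => ‖t‖ * w y) (fun y => t * f y) := by
  intro p hp y
  have e := iteratedFDeriv_const_smul_apply (𝕜 := ℝ) (i := p) (x := y) (a := t)
    ((hf.of_le (by exact_mod_cast le_top : (p : ℕ∞ω) ≤ ∞)).contDiffAt)
  change ‖iteratedFDeriv ℝ p (t • f) y‖ ≤ _
  rw [e, norm_smul]
  exact mul_le_mul_of_nonneg_left (h p hp y) (norm_nonneg _)

lemma mul (hf : ContDiff ℝ ∞ f) (hg : ContDiff ℝ ∞ g) (h : HasBound N w f)
    (h' : HasBound N w' g) : HasBound N (fun y => 2 ^ N * w y * w' y) (fun y => f y * g y) := by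
  intro p hp y
  refine (norm_iteratedFDeriv_mul_le (N := p) (hf.of_le (by exact_mod_cast le_top))
    (hg.of_le (by exact_mod_cast le_top)) y le_rfl).trans ?_
  calc _ ≤ ∑ i ∈ Finset.range (p + 1), (p.choose i : ℝ) * w y * w' y := by
        refine Finset.sum_le_sum fun i hi => ?_
        have hi' : i ≤ p := Nat.lt_succ_iff.mp (Finset.mem_range.mp hi)
        have h0 := h.nonneg y
        exact mul_le_mul (mul_le_mul_of_nonneg_left (h i (hi'.trans hp) y) (by positivity))
          (h' _ ((Nat.sub_le _ _).trans hp) y) (norm_nonneg _) (by positivity)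
    _ = 2 ^ p * w y * w' y := by
        rw [← Finset.sum_mul, ← Finset.sum_mul]
        congr 2
        exact_mod_cast Nat.sum_range_choose p
    _ ≤ _ := by
        exact mul_le_mul_of_nonneg_right (mul_le_mul_of_nonneg_right
          (pow_le_pow_right₀ (by norm_num) hp) (h.nonneg y)) (h'.nonneg y)

lemma translate (h : HasBound N w f) (v : E) :
    HasBound N (fun y => w (y + v)) (fun y => f (y + v)) := by
  intro p hp y
  rw [iteratedFDeriv_comp_add_right]
  exact h p hp _

/-- The p-th derivative acquires `‖L‖ ^ p`; taking `max 1 ‖L‖` allows a single power `N` to serve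
all p ≤ N. -/
lemma comp_clm (hf : ContDiff ℝ ∞ f) (h : HasBound N w f) (L : G →L[ℝ] E) :
    HasBound N (fun y => (max 1 ‖L‖) ^ N * w (L y)) (fun y => f (L y)) := by
  intro p hp y
  have e := L.iteratedFDeriv_comp_right (n := ∞) hf y (i := p) (by exact_mod_cast le_top)
  change ‖iteratedFDeriv ℝ p (f ∘ L) y‖ ≤ _
  rw [e]
  refine (ContinuousMultilinearMap.norm_compContinuousLinearMap_le _ _).trans ?_
  rw [Finset.prod_const, Finset.card_univ, Fintype.card_fin, mul_comm]
  refine mul_le_mul ?_ (h p hp _) (norm_nonneg _) (by positivity)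
  calc ‖L‖ ^ p ≤ (max 1 ‖L‖) ^ p := by gcongr; exact le_max_right _ _
    _ ≤ _ := pow_le_pow_right₀ (le_max_left _ _) hp

lemma fderiv_apply (hf : ContDiff ℝ ∞ f) (h : HasBound (N + 1) w f) (v : E) :
    HasBound N (fun y => ‖v‖ * w y) (fun y => fderiv ℝ f y v) := by
  intro p hp y
  refine (norm_iteratedFDeriv_clm_apply_const (N := p) (f := fderiv ℝ f)
    ?_ le_rfl).trans ?_
  · exact (hf.fderiv_right (m := ∞) (by simp)).contDiffAt.of_le (by exact_mod_cast le_top)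
  · rw [norm_iteratedFDeriv_fderiv]
    exact mul_le_mul_of_nonneg_left (h _ (by omega) y) (norm_nonneg _)

end HasBound

lemma hasBound_const (c : ℂ) (N : ℕ) : HasBound N (fun _ : E => ‖c‖) (fun _ => c) := by
  intro p hp y
  rcases Nat.eq_zero_or_pos p with rfl | h
  · simp
  · rw [iteratedFDeriv_const_of_ne (by omega)]
    simp

namespace Nice

variable {r : ℕ} {f g : E → ℂ}

lemma continuous (hf : Nice r f) : Continuous f := hf.1.continuous

lemma differentiable (hf : Nice r f) : Differentiable ℝ f := hf.1.differentiable (by simp)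

lemma bound (hf : Nice 0 f) (N : ℕ) : ∃ M, 0 ≤ M ∧ HasBound N (fun _ => M) f := by
  simpa using hf.2 N

lemma add (hf : Nice r f) (hg : Nice r g) : Nice r (fun y => f y + g y) := by
  refine ⟨hf.1.add hg.1, fun N => ?_⟩
  obtain ⟨M, hM, hb⟩ := hf.2 N
  obtain ⟨M', hM', hb'⟩ := hg.2 N
  exact ⟨M + M', by positivity, (hb.add hf.1 hg.1 hb').mono le_rfl fun y => by
    rw [add_mul]⟩

lemma const_mul (hf : Nice r f) (t : ℂ) : Nice r (fun y => t * f y) := by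
  refine ⟨contDiff_const.mul hf.1, fun N => ?_⟩
  obtain ⟨M, hM, hb⟩ := hf.2 N
  exact ⟨‖t‖ * M, by positivity, (hb.const_smul hf.1 t).mono le_rfl fun y => by
    rw [mul_assoc]⟩

lemma sub (hf : Nice r f) (hg : Nice r g) : Nice r (fun y => f y - g y) := by
  simpa [sub_eq_add_neg] using hf.add (hg.const_mul (-1))

lemma mul {r' : ℕ} (hf : Nice r f) (hg : Nice r' g) : Nice (r + r') (fun y => f y * g y) := by
  refine ⟨hf.1.mul hg.1, fun N => ?_⟩
  obtain ⟨M, hM, hb⟩ := hf.2 N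
  obtain ⟨M', hM', hb'⟩ := hg.2 N
  refine ⟨2 ^ N * M * M', by positivity, (hb.mul hf.1 hg.1 hb').mono le_rfl fun y => ?_⟩
  rw [decay_add]
  apply le_of_eq; ring

lemma const (c : ℂ) : Nice 0 (fun _ : E => c) :=
  ⟨contDiff_const, fun N => ⟨‖c‖, norm_nonneg _, by simpa using hasBound_const c N⟩⟩

lemma translate (hf : Nice r f) (v : E) : Nice r (fun y => f (y + v)) := by
  refine ⟨hf.1.comp (contDiff_id.add contDiff_const), fun N => ?_⟩
  obtain ⟨M, hM, hb⟩ := hf.2 N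
  refine ⟨M * (1 + ‖v‖) ^ r, by positivity, (hb.translate v).mono le_rfl fun y => ?_⟩
  rw [mul_assoc]
  exact mul_le_mul_of_nonneg_left (decay_translate r y v) hM

lemma comp_clm (hf : Nice 0 f) (L : G →L[ℝ] E) : Nice 0 (fun y => f (L y)) := by
  refine ⟨hf.1.comp L.contDiff, fun N => ?_⟩
  obtain ⟨M, hM, hb⟩ := hf.bound N
  exact ⟨(max 1 ‖L‖) ^ N * M, by positivity, by simpa using hb.comp_clm hf.1 L⟩

lemma fderiv_apply (hf : Nice r f) (v : E) : Nice r (fun y => fderiv ℝ f y v) := by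
  refine ⟨(hf.1.fderiv_right (m := ∞) (by simp)).clm_apply contDiff_const, fun N => ?_⟩
  obtain ⟨M, hM, hb⟩ := hf.2 (N + 1)
  exact ⟨‖v‖ * M, by positivity, (hb.fderiv_apply hf.1 v).mono le_rfl fun y => by rw [mul_assoc]⟩

end Nice

lemma fderiv_fderiv_apply_comm {F : Type*} [NormedAddCommGroup F] [NormedSpace ℝ F] {g : E → F}
    (hg : ContDiff ℝ 2 g) (y v w : E) :
    fderiv ℝ (fun z => fderiv ℝ g z v) y w = fderiv ℝ (fun z => fderiv ℝ g z w) y v := by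
  have hd : DifferentiableAt ℝ (fderiv ℝ g) y :=
    (hg.fderiv_right (m := 1) (by norm_num)).differentiable (by simp) y
  have hs : IsSymmSndFDerivAt ℝ g y :=
    hg.contDiffAt.isSymmSndFDerivAt (by simp)
  rw [fderiv_clm_apply hd (differentiableAt_const v),
    fderiv_clm_apply hd (differentiableAt_const w)]
  simpa using hs w v

/-- By symmetry of second derivatives, applied to D^p f at each induction step, the direction `v`
can be moved past the other ones. -/
lemma fderiv_iteratedFDeriv_apply {f : E → ℂ} (hf : ContDiff ℝ ∞ f) (p : ℕ) (y v : E) :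
    fderiv ℝ (iteratedFDeriv ℝ p f) y v = iteratedFDeriv ℝ p (fun z => fderiv ℝ f z v) y := by
  induction p generalizing y with
  | zero =>
    have e : iteratedFDeriv ℝ 0 f = (continuousMultilinearCurryFin0 ℝ E ℂ).symm ∘ f :=
      iteratedFDeriv_zero_eq_comp
    rw [e, LinearIsometryEquiv.comp_fderiv, iteratedFDeriv_zero_eq_comp]
    rfl
  | succ p ih =>
    have hi (q : ℕ) : ContDiff ℝ ∞ (iteratedFDeriv ℝ q f) :=
      contDiff_infty.2 fun n => hf.iteratedFDeriv_right (m := n) (i := q) (by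
        exact_mod_cast le_top)
    have hp : ContDiff ℝ 2 (iteratedFDeriv ℝ p f) := contDiff_infty.1 (hi p) 2
    have hfun : (fun z => fderiv ℝ (iteratedFDeriv ℝ p f) z v)
        = iteratedFDeriv ℝ p (fun z => fderiv ℝ f z v) := funext fun z => ih z
    have hd (w : E) : DifferentiableAt ℝ (fun z => fderiv ℝ (iteratedFDeriv ℝ p f) z w) y :=
      ((hp.fderiv_right (m := 1) (by norm_num)).differentiable (by simp) y).clm_apply
        (differentiableAt_const w)
    ext m
    rw [← fderiv_continuousMultilinear_apply_const_apply ((hi (p + 1)).differentiable (by simp) y)]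
    simp only [iteratedFDeriv_succ_apply_left]
    rw [fderiv_continuousMultilinear_apply_const_apply (hd _), ← hfun,
      fderiv_fderiv_apply_comm hp]

/-- First and second order Taylor estimates for translations in the weighted `C^N` norms. -/
lemma Nice.taylor {r : ℕ} {f : E → ℂ} (hf : Nice r f) (N : ℕ) :
    ∃ C : ℝ, 0 ≤ C ∧ ∀ v : E, ‖v‖ ≤ 1 →
      HasBound N (fun y => C * ‖v‖ * decay r y) (fun y => f (y + v) - f y) ∧
      HasBound N (fun y => C * ‖v‖ ^ 2 * decay r y)
        (fun y => f (y + v) - f y - fderiv ℝ f y v) := by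
  -- Mean value inequality on the segment from y to y + v, where the weight varies by at most `2 ^
  -- r` because ‖v‖ ≤ 1. It is stated for general `g` so that it can be reused for the directional
  -- derivative of `f`.
  have first : ∀ {g : E → ℂ} {N : ℕ} {M : ℝ}, ContDiff ℝ ∞ g → 0 ≤ M →
      HasBound (N + 1) (fun y => M * decay r y) g → ∀ v : E, ‖v‖ ≤ 1 →
      HasBound N (fun y => 2 ^ r * M * ‖v‖ * decay r y) (fun y => g (y + v) - g y) := by
    intro g N M hg hM hb v hv p hp y
    have hgp : ContDiff ℝ 1 (iteratedFDeriv ℝ p g) :=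
      hg.iteratedFDeriv_right (m := 1) (i := p) (by exact_mod_cast le_top)
    have e := fun_iteratedFDeriv_sub_apply (𝕜 := ℝ) (f := fun y => g (y + v)) (g := g) (i := p)
      (x := y) (((hg.comp (contDiff_id.add contDiff_const)).of_le
        (by exact_mod_cast le_top)).contDiffAt) ((hg.of_le (by exact_mod_cast le_top)).contDiffAt)
    rw [e, iteratedFDeriv_comp_add_right]
    have := (convex_segment (𝕜 := ℝ) y (y + v)).norm_image_sub_le_of_norm_fderiv_le
      (f := iteratedFDeriv ℝ p g) (C := M * (2 ^ r * decay r y))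
      (fun z _ => hgp.differentiable (by simp) z) ?_ (left_mem_segment ℝ _ _)
      (right_mem_segment ℝ _ _)
    · refine this.trans (le_of_eq ?_)
      rw [add_sub_cancel_left]; ring
    · intro z hz
      rw [segment_eq_image'] at hz
      obtain ⟨t, ⟨ht0, ht1⟩, rfl⟩ := hz
      rw [norm_fderiv_iteratedFDeriv]
      refine (hb _ (by omega) _).trans (mul_le_mul_of_nonneg_left ?_ hM)
      refine (decay_translate r y _).trans
        (mul_le_mul_of_nonneg_right ?_ (decay_pos r y).le)
      gcongr
      have : ‖t • (y + v - y)‖ ≤ 1 := by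
        rw [add_sub_cancel_left, norm_smul, Real.norm_of_nonneg ht0]
        nlinarith [norm_nonneg v]
      linarith
  obtain ⟨M, hM, hb⟩ := hf.2 (N + 2)
  refine ⟨2 ^ r * M, by positivity, fun v hv => ⟨?_, ?_⟩⟩
  · exact first hf.1 hM (hb.mono (by omega) fun _ => le_rfl) v hv
  intro p hp y
  have hfv : ContDiff ℝ ∞ (fun y => f (y + v)) := hf.1.comp (contDiff_id.add contDiff_const)
  have hdv : ContDiff ℝ ∞ (fun y => fderiv ℝ f y v) := (hf.fderiv_apply v).1
  have hgp : ContDiff ℝ 1 (iteratedFDeriv ℝ p f) :=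
    hf.1.iteratedFDeriv_right (m := 1) (i := p) (by exact_mod_cast le_top)
  have le (p : ℕ) : (p : ℕ∞ω) ≤ ∞ := by exact_mod_cast le_top
  have e := fun_iteratedFDeriv_sub_apply (𝕜 := ℝ) (f := fun y => f (y + v) - f y)
    (g := fun y => fderiv ℝ f y v) (i := p) (x := y) ((hfv.sub hf.1).of_le (le p)).contDiffAt
    (hdv.of_le (le p)).contDiffAt
  have e' := fun_iteratedFDeriv_sub_apply (𝕜 := ℝ) (f := fun y => f (y + v)) (g := f) (i := p)
      (x := y) (hfv.of_le (le p)).contDiffAt (hf.1.of_le (le p)).contDiffAt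
  rw [e, e', iteratedFDeriv_comp_add_right, ← fderiv_iteratedFDeriv_apply hf.1]
  -- The path t ↦ D^p f(y + tv) - t D(D^p f)(y)v has as velocity a first difference of D^p(∂_v f),
  -- which `first` bounds by a multiple of ‖v‖ · ‖tv‖.
  have := (convex_Icc (0 : ℝ) 1).norm_image_sub_le_of_norm_hasDerivWithin_le
    (f := fun t : ℝ => iteratedFDeriv ℝ p f (y + t • v) -
      t • fderiv ℝ (iteratedFDeriv ℝ p f) y v)
    (f' := fun t : ℝ => fderiv ℝ (iteratedFDeriv ℝ p f) (y + t • v) v -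
      fderiv ℝ (iteratedFDeriv ℝ p f) y v)
    (C := 2 ^ r * M * ‖v‖ ^ 2 * decay r y) (x := 0) (y := 1) ?_ ?_ (by simp) (by simp)
  · simpa [sub_sub, add_comm] using this
  · intro t _
    apply HasDerivAt.hasDerivWithinAt
    apply HasDerivAt.sub
    · have h1 : HasDerivAt (fun t : ℝ => y + t • v) v t := by
        simpa using ((hasDerivAt_id t).smul_const v).const_add y
      exact ((hgp.differentiable (by simp) (y + t • v)).hasFDerivAt).comp_hasDerivAt t h1
    · simpa using (hasDerivAt_id t).smul_const (fderiv ℝ (iteratedFDeriv ℝ p f) y v)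
  · intro t ht
    have ht1 : ‖t • v‖ ≤ ‖v‖ := by
      rw [norm_smul, Real.norm_of_nonneg ht.1]
      exact mul_le_of_le_one_left (norm_nonneg _) ht.2
    rw [fderiv_iteratedFDeriv_apply hf.1, fderiv_iteratedFDeriv_apply hf.1]
    have h2 := first hdv (by positivity : 0 ≤ ‖v‖ * M) (N := N)
      (((hb.fderiv_apply hf.1 v).mono le_rfl fun y => by rw [mul_assoc])) (t • v) (ht1.trans hv)
      p hp y
    rw [fun_iteratedFDeriv_sub_apply (𝕜 := ℝ) (f := fun y => fderiv ℝ f (y + t • v) v)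
      ((hdv.comp (contDiff_id.add contDiff_const)).of_le (le p)).contDiffAt
      (hdv.of_le (le p)).contDiffAt,
      iteratedFDeriv_comp_add_right (f := fun y => fderiv ℝ f y v)] at h2
    refine h2.trans ?_
    have := decay_pos r y
    calc _ ≤ 2 ^ r * (‖v‖ * M) * ‖v‖ * decay r y := by
          refine mul_le_mul_of_nonneg_right ?_ this.le
          exact mul_le_mul_of_nonneg_left ht1 (by positivity)
      _ = _ := by ring

end Calculus

/-! ### Leibniz rule for bounded bilinear forms along translations -/

section BilinearForms

open Filter Topology Asymptotics

variable {E : Type*} [NormedAddCommGroup E] [NormedSpace ℝ E]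
  {G : Type*} [NormedAddCommGroup G] [NormedSpace ℝ G]
  {X : Type*} [NormedAddCommGroup X] [NormedSpace ℝ X] [FiniteDimensional ℝ X]

/-- A bilinear form on `Nice r × Nice r'`, continuous for the weighted `C^N` norms. -/
structure BoundedForm (r r' : ℕ) (B : (E → ℂ) → (G → ℂ) → ℂ) : Prop where
  add_left : ∀ f f' g, Nice r f → Nice r f' → Nice r' g →
    B (fun y => f y + f' y) g = B f g + B f' g
  smul_left : ∀ (t : ℂ) f g, Nice r f → Nice r' g → B (fun y => t * f y) g = t * B f g
  add_right : ∀ f g g', Nice r f → Nice r' g → Nice r' g' →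
    B f (fun y => g y + g' y) = B f g + B f g'
  smul_right : ∀ (t : ℂ) f g, Nice r f → Nice r' g → B f (fun y => t * g y) = t * B f g
  bound : ∃ (K : ℝ) (N : ℕ), 0 ≤ K ∧ ∀ f g M M', Nice r f → Nice r' g → 0 ≤ M → 0 ≤ M' →
    HasBound N (fun y => M * decay r y) f → HasBound N (fun y => M' * decay r' y) g →
    ‖B f g‖ ≤ K * M * M'

namespace BoundedForm

variable {r r' : ℕ} {B : (E → ℂ) → (G → ℂ) → ℂ}

/-- The form evaluated at simultaneous translates of `f` and `g`. -/
def translated (B : (E → ℂ) → (G → ℂ) → ℂ) (ι : X →L[ℝ] E) (κ : X →L[ℝ] G)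
    (f : E → ℂ) (g : G → ℂ) (x : X) : ℂ :=
  B (fun y => f (y + ι x)) (fun y => g (y + κ x))

/-- The derivative of `BoundedForm.translated`. -/
noncomputable def derivMap (hB : BoundedForm r r' B) (ι : X →L[ℝ] E) (κ : X →L[ℝ] G)
    {f : E → ℂ} {g : G → ℂ} (hf : Nice r f) (hg : Nice r' g) (x : X) : X →L[ℝ] ℂ :=
  LinearMap.toContinuousLinearMap
    { toFun := fun v =>
        translated B ι κ (fun y => fderiv ℝ f y (ι v)) g x +
          translated B ι κ f (fun y => fderiv ℝ g y (κ v)) x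
      map_add' := fun v w => by
        simp only [translated, map_add]
        rw [hB.add_left _ _ _ ((hf.fderiv_apply _).translate _) ((hf.fderiv_apply _).translate _)
          (hg.translate _), hB.add_right _ _ _ (hf.translate _) ((hg.fderiv_apply _).translate _)
          ((hg.fderiv_apply _).translate _)]
        ring
      map_smul' := fun t v => by
        simp only [translated, map_smul, RingHom.id_apply, Complex.real_smul]
        rw [hB.smul_left _ _ _ ((hf.fderiv_apply _).translate _) (hg.translate _),
          hB.smul_right _ _ _ (hf.translate _) ((hg.fderiv_apply _).translate _)]
        ring }

lemma derivMap_apply (hB : BoundedForm r r' B) (ι : X →L[ℝ] E) (κ : X →L[ℝ] G)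
    {f : E → ℂ} {g : G → ℂ} (hf : Nice r f) (hg : Nice r' g) (x v : X) :
    hB.derivMap ι κ hf hg x v = translated B ι κ (fun y => fderiv ℝ f y (ι v)) g x +
          translated B ι κ f (fun y => fderiv ℝ g y (κ v)) x := rfl

lemma hasFDerivAt (hB : BoundedForm r r' B) (ι : X →L[ℝ] E) (κ : X →L[ℝ] G)
    {f : E → ℂ} {g : G → ℂ} (hf : Nice r f) (hg : Nice r' g) (x : X) :
    HasFDerivAt (translated B ι κ f g) (hB.derivMap ι κ hf hg x) x := by
  obtain ⟨K, N, hK, hb⟩ := hB.bound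
  have hf0 := hf.translate (ι x)
  have hg0 := hg.translate (κ x)
  set f0 : E → ℂ := fun y => f (y + ι x) with hf0def
  set g0 : G → ℂ := fun y => g (y + κ x) with hg0def
  obtain ⟨C, hC, hT⟩ := hf0.taylor N
  obtain ⟨C', hC', hT'⟩ := hg0.taylor N
  obtain ⟨M, hM, hbM⟩ := hf0.2 N
  obtain ⟨M', hM', hbM'⟩ := hg0.2 N
  have df (v : E) : (fun y => fderiv ℝ f (y + ι x) v) = fun y => fderiv ℝ f0 y v := by
    funext y; rw [hf0def, fderiv_comp_add_right]
  have dg (v : G) : (fun y => fderiv ℝ g (y + κ x) v) = fun y => fderiv ℝ g0 y v := by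
    funext y; rw [hg0def, fderiv_comp_add_right]
  rw [hasFDerivAt_iff_isLittleO_nhds_zero]
  -- After bilinear expansion the error consists of a second-order Taylor remainder in either slot
  -- and the form of two first differences; each is O(‖v‖²).
  have key : (fun v : X => translated B ι κ f g (x + v) - translated B ι κ f g x -
      hB.derivMap ι κ hf hg x v) =O[𝓝 0] fun v : X => ‖v‖ ^ 2 := by
    have hι : ∀ᶠ v : X in 𝓝 0, ‖ι v‖ < 1 := by
      have : ContinuousAt (fun v : X => ‖ι v‖) 0 := by fun_prop
      exact this.eventually_lt_const (by simp)
    have hκ : ∀ᶠ v : X in 𝓝 0, ‖κ v‖ < 1 := by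
      have : ContinuousAt (fun v : X => ‖κ v‖) 0 := by fun_prop
      exact this.eventually_lt_const (by simp)
    refine IsBigO.of_bound (K * (C * ‖ι‖ ^ 2) * M' + K * M * (C' * ‖κ‖ ^ 2) +
      K * (C * ‖ι‖) * (C' * ‖κ‖)) ?_
    filter_upwards [hι, hκ] with v hv hv'
    obtain ⟨h1, h2⟩ := hT (ι v) hv.le
    obtain ⟨h1', h2'⟩ := hT' (κ v) hv'.le
    have nf1 := (hf0.translate (ι v)).sub hf0
    have nf2 := nf1.sub (hf0.fderiv_apply (ι v))
    have ng1 := (hg0.translate (κ v)).sub hg0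
    have ng2 := ng1.sub (hg0.fderiv_apply (κ v))
    have e1 : translated B ι κ f g (x + v) =
        B (fun y => f0 y + (f0 (y + ι v) - f0 y)) (fun y => g0 y + (g0 (y + κ v) - g0 y)) := by
      simp only [translated, hf0def, hg0def, map_add]
      congr 1 <;> · funext y; rw [add_sub_cancel]; congr 1; abel
    have e2 : B (fun y => f0 (y + ι v) - f0 y) g0 =
        B (fun y => f0 (y + ι v) - f0 y - fderiv ℝ f0 y (ι v)) g0 +
          B (fun y => fderiv ℝ f0 y (ι v)) g0 := by
      rw [← hB.add_left _ _ _ nf2 (hf0.fderiv_apply _) hg0]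
      simp
    have e3 : B f0 (fun y => g0 (y + κ v) - g0 y) =
        B f0 (fun y => g0 (y + κ v) - g0 y - fderiv ℝ g0 y (κ v)) +
          B f0 (fun y => fderiv ℝ g0 y (κ v)) := by
      rw [← hB.add_right _ _ _ hf0 ng2 (hg0.fderiv_apply _)]
      simp
    have e4 : translated B ι κ f g (x + v) - translated B ι κ f g x -
        hB.derivMap ι κ hf hg x v =
        B (fun y => f0 (y + ι v) - f0 y - fderiv ℝ f0 y (ι v)) g0 +
        B f0 (fun y => g0 (y + κ v) - g0 y - fderiv ℝ g0 y (κ v)) +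
        B (fun y => f0 (y + ι v) - f0 y) (fun y => g0 (y + κ v) - g0 y) := by
      rw [e1, derivMap_apply, hB.add_left _ _ _ hf0 nf1 (hg0.add ng1),
        hB.add_right _ _ _ hf0 hg0 ng1, hB.add_right _ _ _ nf1 hg0 ng1, e2, e3]
      simp only [translated, df, dg]
      ring
    rw [e4]
    refine (norm_add₃_le).trans ?_
    have iv : ‖ι v‖ ≤ ‖ι‖ * ‖v‖ := ι.le_opNorm v
    have kv : ‖κ v‖ ≤ ‖κ‖ * ‖v‖ := κ.le_opNorm v
    have b1 := hb _ _ _ _ nf2 hg0 (by positivity) hM' h2 hbM'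
    have b2 := hb _ _ _ _ hf0 ng2 hM (by positivity) hbM h2'
    have b3 := hb _ _ _ _ nf1 ng1 (by positivity) (by positivity) h1 h1'
    calc _ ≤ K * (C * ‖ι v‖ ^ 2) * M' + K * M * (C' * ‖κ v‖ ^ 2) +
          K * (C * ‖ι v‖) * (C' * ‖κ v‖) := add_le_add (add_le_add b1 b2) b3
      _ ≤ K * (C * (‖ι‖ * ‖v‖) ^ 2) * M' + K * M * (C' * (‖κ‖ * ‖v‖) ^ 2) +
          K * (C * (‖ι‖ * ‖v‖)) * (C' * (‖κ‖ * ‖v‖)) := by gcongr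
      _ = _ := by rw [Real.norm_of_nonneg (by positivity)]; ring
  refine key.trans_isLittleO ?_
  simpa using (isLittleO_norm_pow_id (E' := X) one_lt_two)

lemma fderiv_translated (hB : BoundedForm r r' B) (ι : X →L[ℝ] E) (κ : X →L[ℝ] G)
    {f : E → ℂ} {g : G → ℂ} (hf : Nice r f) (hg : Nice r' g) (x v : X) :
    fderiv ℝ (translated B ι κ f g) x v =
      translated B ι κ (fun y => fderiv ℝ f y (ι v)) g x +
        translated B ι κ f (fun y => fderiv ℝ g y (κ v)) x := by
  rw [(hB.hasFDerivAt ι κ hf hg x).fderiv, derivMap_apply]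

/-- The Leibniz formula writes the derivative in each fixed direction as a sum of translated forms
of the same type, so the order of smoothness is raised by induction over all `f` and `g` at once. -/
lemma contDiff_translated (hB : BoundedForm r r' B) (ι : X →L[ℝ] E) (κ : X →L[ℝ] G)
    {f : E → ℂ} {g : G → ℂ} (hf : Nice r f) (hg : Nice r' g) :
    ContDiff ℝ ∞ (translated B ι κ f g) := by
  refine contDiff_infty.2 fun n => ?_
  induction n generalizing f g with
  | zero =>
    exact contDiff_zero.2 <| continuous_iff_continuousAt.2 fun x =>
      (hB.hasFDerivAt ι κ hf hg x).continuousAt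
  | succ n ih =>
    push_cast
    refine contDiff_succ_iff_fderiv.2
      ⟨fun x => (hB.hasFDerivAt ι κ hf hg x).differentiableAt, by simp, ?_⟩
    refine contDiff_clm_apply_iff.2 fun v => ?_
    simp only [hB.fderiv_translated ι κ hf hg]
    exact (ih (hf.fderiv_apply _) hg).add (ih hf (hg.fderiv_apply _))

end BoundedForm

end BilinearForms

/-! ### Quantitative Fourier transform bounds -/

section Fourier

open Filter Topology Module
open scoped FourierTransform RealInnerProductSpace

/-- Smooth functions all of whose derivatives decay rapidly. -/
def Rapid {E : Type*} [NormedAddCommGroup E] [NormedSpace ℝ E] (f : E → ℂ) : Prop :=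
  ∀ r, Nice r f

lemma _root_.SchwartzMap.rapid {E : Type*} [NormedAddCommGroup E] [NormedSpace ℝ E]
    (u : 𝓢(E, ℂ)) : Rapid (u : E → ℂ) := by
  refine fun r => ⟨u.smooth ⊤, fun N => ?_⟩
  refine ⟨2 ^ r * (Finset.Iic (r, N)).sup (fun m => SchwartzMap.seminorm ℝ m.1 m.2) u,
    by positivity, fun p hp y => ?_⟩
  have := SchwartzMap.one_add_le_sup_seminorm_apply (𝕜 := ℝ) (m := (r, N)) (k := r) (n := p)
    le_rfl hp u y
  simp only [decay]
  rw [← div_eq_mul_inv, le_div_iff₀ (by positivity), mul_comm]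
  exact this

lemma _root_.HasCompactSupport.rapid {E : Type*} [NormedAddCommGroup E] [NormedSpace ℝ E]
    {f : E → ℂ} (h : HasCompactSupport f) (hf : ContDiff ℝ ∞ f) : Rapid f :=
  (h.toSchwartzMap hf).rapid

section Decay

variable {V : Type*} [NormedAddCommGroup V] [NormedSpace ℝ V] [FiniteDimensional ℝ V]
  [MeasurableSpace V] [BorelSpace V]

lemma integrable_decay (μ : Measure V) [μ.IsAddHaarMeasure] :
    Integrable (decay (finrank ℝ V + 1) : V → ℝ) μ := by
  have := integrable_one_add_norm (E := V) (μ := μ) (r := (finrank ℝ V + 1 : ℕ)) (by simp)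
  refine this.congr (Eventually.of_forall fun x => ?_)
  simp only [decay]
  rw [Real.rpow_neg (by positivity), Real.rpow_natCast]

lemma integrable_of_norm_le_decay {μ : Measure V} [μ.IsAddHaarMeasure] {f : V → ℂ} {M : ℝ}
    (hf : AEStronglyMeasurable f μ) (h : ∀ y, ‖f y‖ ≤ M * decay (finrank ℝ V + 1) y) :
    Integrable f μ :=
  ((integrable_decay μ).const_mul M).mono' hf (Eventually.of_forall h)

lemma Nice.integrable {μ : Measure V} [μ.IsAddHaarMeasure] {f : V → ℂ}
    (hf : Nice (finrank ℝ V + 1) f) : Integrable f μ := by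
  obtain ⟨M, hM, hb⟩ := hf.2 0
  exact integrable_of_norm_le_decay hf.continuous.aestronglyMeasurable hb.norm_le

end Decay

variable {V : Type*} [NormedAddCommGroup V] [InnerProductSpace ℝ V] [FiniteDimensional ℝ V]
  [MeasurableSpace V] [BorelSpace V]

lemma integrable_pow_mul_iteratedFDeriv {f : V → ℂ} {M : ℝ} {N q : ℕ} (hf : ContDiff ℝ ∞ f)
    (hb : HasBound N (fun y => M * decay (finrank ℝ V + 1 + q) y) f) {k n : ℕ} (hk : k ≤ q)
    (hn : n ≤ N) : (∀ v, ‖v‖ ^ k * ‖iteratedFDeriv ℝ n f v‖ ≤ M * decay (finrank ℝ V + 1) v) ∧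
      Integrable (fun v => ‖v‖ ^ k * ‖iteratedFDeriv ℝ n f v‖) := by
  have h1 : ∀ v, ‖v‖ ^ k * ‖iteratedFDeriv ℝ n f v‖ ≤ M * decay (finrank ℝ V + 1) v := by
    intro v
    have h2 := hb n hn v
    have hM : 0 ≤ M * decay (finrank ℝ V + 1) v := by
      have : 0 ≤ M := by
        have := hb.nonneg v
        exact nonneg_of_mul_nonneg_left this (decay_pos _ _)
      exact mul_nonneg this (decay_pos _ _).le
    calc ‖v‖ ^ k * ‖iteratedFDeriv ℝ n f v‖
        ≤ (1 + ‖v‖) ^ q * (M * decay (finrank ℝ V + 1 + q) v) := by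
          refine mul_le_mul ?_ h2 (norm_nonneg _) (by positivity)
          calc ‖v‖ ^ k ≤ (1 + ‖v‖) ^ k := by gcongr; linarith
            _ ≤ _ := pow_le_pow_right₀ (by linarith [norm_nonneg v]) hk
      _ = M * decay (finrank ℝ V + 1) v := by
          rw [decay_add, decay, decay]
          field_simp
  refine ⟨h1, ((integrable_decay volume).const_mul M).mono' ?_ (Eventually.of_forall fun v => ?_)⟩
  · have : Continuous (iteratedFDeriv ℝ n f) :=
      (hf.of_le (by exact_mod_cast le_top : (n : ℕ∞ω) ≤ ∞)).continuous_iteratedFDeriv'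
    exact (by fun_prop : Continuous fun v => ‖v‖ ^ k * ‖iteratedFDeriv ℝ n f v‖).aestronglyMeasurable
  · rw [Real.norm_of_nonneg (by positivity)]
    exact h1 v

variable (V) in
-- The usual exchange, with finite orders: `N` derivatives of `f` become `N` powers of decay, and
-- `q` powers of decay beyond integrability become `q` derivatives.
lemma exists_hasBound_fourier (N q : ℕ) : ∃ C : ℝ, 0 ≤ C ∧ ∀ (f : V → ℂ) (M : ℝ),
    ContDiff ℝ ∞ f → HasBound N (fun y => M * decay (finrank ℝ V + 1 + q) y) f →
    HasBound q (fun ξ => C * M * decay N ξ) (𝓕 f) := by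
  set I : ℝ := ∫ v : V, decay (finrank ℝ V + 1) v
  have hI : 0 ≤ I := integral_nonneg fun v => (decay_pos _ _).le
  -- The factor (q + 1)(N + 1) counts the seminorm integrals in the estimate for 𝓕 f, each at most
  -- `M * I`.
  set A : ℝ := (2 * Real.pi + 1) ^ q * (2 * q + 2) ^ N * ((q + 1 : ℕ) * (N + 1 : ℕ)) * I with hA
  refine ⟨2 ^ N * (A + A), by positivity, fun f M hf hb => ?_⟩
  intro k hk w
  have hM : 0 ≤ M := by
    have := hb.nonneg 0
    exact nonneg_of_mul_nonneg_left this (decay_pos _ _)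
  have key : ∀ n ≤ N, ‖w‖ ^ n * ‖iteratedFDeriv ℝ k (𝓕 f) w‖ ≤ A * M := by
    intro n hn
    have := Real.pow_mul_norm_iteratedFDeriv_fourier_le (K := q) (N := N) (f := f)
      (hf.of_le (by exact_mod_cast le_top))
      (fun k n hk hn => (integrable_pow_mul_iteratedFDeriv hf hb (by exact_mod_cast hk)
        (by exact_mod_cast hn)).2)
      (k := k) (n := n) (by exact_mod_cast hk) (by exact_mod_cast hn) w
    refine this.trans ?_
    calc _ ≤ (2 * Real.pi + 1) ^ q * (2 * q + 2) ^ N *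
          ∑ p ∈ Finset.range (q + 1) ×ˢ Finset.range (N + 1), M * I := by
          refine mul_le_mul (mul_le_mul ?_ ?_ (by positivity) (by positivity)) ?_ ?_
            (by positivity)
          · calc (2 * Real.pi) ^ k ≤ (2 * Real.pi + 1) ^ k := by gcongr; linarith
              _ ≤ _ := pow_le_pow_right₀ (by linarith [Real.pi_pos]) hk
          · have hkq : (k : ℝ) ≤ q := by exact_mod_cast hk
            calc ((2 : ℝ) * k + 2) ^ n ≤ (2 * q + 2) ^ n := by gcongr
              _ ≤ _ := pow_le_pow_right₀ (by linarith [(Nat.cast_nonneg q : (0 : ℝ) ≤ q)]) hn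
          · refine (Finset.sum_le_sum fun p hp => ?_).trans
              (Finset.sum_le_sum_of_subset_of_nonneg (f := fun _ => M * I) ?_ ?_)
            · simp only [Finset.mem_product, Finset.mem_range] at hp
              have h3 := integrable_pow_mul_iteratedFDeriv hf hb (k := p.1) (n := p.2)
                (by omega) (by omega)
              calc _ ≤ ∫ v : V, M * decay (finrank ℝ V + 1) v :=
                    integral_mono h3.2 ((integrable_decay volume).const_mul M) h3.1
                _ = M * I := integral_const_mul _ _
            · exact Finset.product_subset_product (Finset.range_mono (by omega))
                (Finset.range_mono (by omega))
            · intros; positivity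
          · exact Finset.sum_nonneg fun p _ => integral_nonneg fun v => by positivity
      _ = A * M := by
          rw [Finset.sum_const, Finset.card_product, Finset.card_range, Finset.card_range, hA]
          simp only [nsmul_eq_mul]
          push_cast
          ring
  have h0 := key 0 (Nat.zero_le _)
  have hN := key N le_rfl
  simp only [decay]
  rw [← div_eq_mul_inv, le_div_iff₀ (by positivity), mul_comm]
  -- The full weight is controlled by the two moments n = 0 and n = N alone.
  have hp : (1 + ‖w‖) ^ N ≤ 2 ^ N * (1 + ‖w‖ ^ N) := by
    rcases le_total ‖w‖ 1 with h | h
    · calc (1 + ‖w‖) ^ N ≤ 2 ^ N := by gcongr; linarith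
        _ ≤ _ := le_mul_of_one_le_right (by positivity) (by linarith [pow_nonneg (norm_nonneg w) N])
    · calc (1 + ‖w‖) ^ N ≤ (2 * ‖w‖) ^ N := by gcongr; linarith
        _ = 2 ^ N * ‖w‖ ^ N := mul_pow _ _ _
        _ ≤ _ := by gcongr; linarith
  calc _ ≤ 2 ^ N * (1 + ‖w‖ ^ N) * ‖iteratedFDeriv ℝ k (𝓕 f) w‖ := by gcongr
    _ = 2 ^ N * (‖w‖ ^ 0 * ‖iteratedFDeriv ℝ k (𝓕 f) w‖ +
          ‖w‖ ^ N * ‖iteratedFDeriv ℝ k (𝓕 f) w‖) := by ring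
    _ ≤ 2 ^ N * (A * M + A * M) := by gcongr
    _ = _ := by ring

lemma Rapid.contDiff_fourier {f : V → ℂ} (hf : Rapid f) : ContDiff ℝ ∞ (𝓕 f) := by
  refine Real.contDiff_fourier (N := ⊤) fun n _ => ?_
  obtain ⟨M, hM, hb⟩ := (hf (finrank ℝ V + 1 + n)).2 0
  simpa using (integrable_pow_mul_iteratedFDeriv (hf 0).1 hb (k := n) (n := 0) le_rfl le_rfl).2

lemma Rapid.fourier {f : V → ℂ} (hf : Rapid f) : Rapid (𝓕 f) := by
  intro r
  refine ⟨hf.contDiff_fourier, fun q => ?_⟩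
  obtain ⟨C, hC, h⟩ := exists_hasBound_fourier V r q
  obtain ⟨M, hM, hb⟩ := (hf (finrank ℝ V + 1 + q)).2 r
  exact ⟨C * M, by positivity, h f M (hf 0).1 hb⟩

lemma Rapid.integrable {f : V → ℂ} (hf : Rapid f) : Integrable f := (hf _).integrable

lemma Rapid.fourierInv_fourier {f : V → ℂ} (hf : Rapid f) : 𝓕⁻ (𝓕 f) = f :=
  (hf 0).continuous.fourierInv_fourier_eq hf.integrable hf.fourier.integrable

lemma Rapid.fourier_fourier {f : V → ℂ} (hf : Rapid f) (k : V) : 𝓕 (𝓕 f) k = f (-k) := by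
  rw [← congrFun hf.fourierInv_fourier (-k), Real.fourierInv_eq_fourier_neg, neg_neg]

end Fourier

/-! ### Oscillatory integrals by localization -/

section Pairing

open Filter Topology Module
open scoped FourierTransform RealInnerProductSpace

variable {V : Type*} [NormedAddCommGroup V] [InnerProductSpace ℝ V] [FiniteDimensional ℝ V]
  [MeasurableSpace V] [BorelSpace V]

/-- A smooth compactly supported function with integral one. -/
noncomputable def window (w : V) : ℂ := ((default : ContDiffBump (0 : V)).normed volume w : ℝ)

lemma contDiff_window : ContDiff ℝ ∞ (window : V → ℂ) :=
  Complex.ofRealCLM.contDiff.comp (ContDiffBump.contDiff_normed _)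

lemma hasCompactSupport_window : HasCompactSupport (window : V → ℂ) :=
  (ContDiffBump.hasCompactSupport_normed (default : ContDiffBump (0 : V))).comp_left
    (g := fun x : ℝ => (x : ℂ)) (by simp)

lemma rapid_window : Rapid (window : V → ℂ) := hasCompactSupport_window.rapid contDiff_window

lemma integral_window : ∫ w : V, window w = 1 := by
  simp only [window]
  rw [integral_complex_ofReal, ContDiffBump.integral_normed]
  simp

/-- The part of `a` near `k`, moved to the origin. -/
noncomputable def localized (a : V → ℂ) (k w : V) : ℂ := a (w + k) * window w

/-- The oscillatory integral `∫ F · 𝓕 a` for functions `a` with bounded derivatives, obtained by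
cutting `a` into pieces localized near the points `k`. -/
noncomputable def pairing (F a : V → ℂ) : ℂ :=
  ∫ k, 𝓕 (fun ζ => F ζ * 𝓕 (localized a k) ζ) k

variable (V) in
-- The window decays to any order: `r` powers trade the weight at w + k for the weight at k by
-- Peetre's inequality, and `r'` powers remain.
lemma exists_hasBound_localized (r r' N : ℕ) : ∃ C : ℝ, 0 ≤ C ∧ ∀ (a : V → ℂ) (M : ℝ) (k : V),
    ContDiff ℝ ∞ a → HasBound N (fun y => M * decay r y) a →
    HasBound N (fun w => C * M * decay r k * decay r' w) (localized a k) := by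
  obtain ⟨G, hG, hb⟩ := (rapid_window (V := V) (r + r')).2 N
  refine ⟨2 ^ N * G, by positivity, fun a M k ha h => ?_⟩
  refine ((h.translate k).mul (ha.comp (contDiff_id.add contDiff_const)) contDiff_window
    hb).mono le_rfl fun w => ?_
  have hM : 0 ≤ M := nonneg_of_mul_nonneg_left (h.nonneg 0) (decay_pos _ _)
  have h1 : decay r (w + k) * decay r w ≤ decay r k := by
    have := decay_translate r k w
    rw [add_comm k w] at this
    calc _ ≤ (1 + ‖w‖) ^ r * decay r k * decay r w :=
          mul_le_mul_of_nonneg_right this (decay_pos _ _).le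
      _ = decay r k := by simp only [decay]; field_simp
  calc _ = 2 ^ N * G * M * (decay r (w + k) * decay r w) * decay r' w := by rw [decay_add]; ring
    _ ≤ 2 ^ N * G * M * decay r k * decay r' w := by
      refine mul_le_mul_of_nonneg_right ?_ (decay_pos _ _).le
      exact mul_le_mul_of_nonneg_left h1 (by positivity)

lemma rapid_localized {a : V → ℂ} (ha : Nice 0 a) (k : V) : Rapid (localized a k) := by
  intro r
  have := (ha.translate k).mul (rapid_window (V := V) r)
  rwa [zero_add] at this

variable (V) in
lemma exists_hasBound_fourier_localized (r q N : ℕ) : ∃ C : ℝ, 0 ≤ C ∧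
    ∀ (a : V → ℂ) (M : ℝ) (k : V),
    ContDiff ℝ ∞ a → HasBound N (fun y => M * decay r y) a →
    HasBound q (fun w => C * M * decay r k * decay N w) (𝓕 (localized a k)) := by
  obtain ⟨C, hC, h⟩ := exists_hasBound_localized V r (finrank ℝ V + 1 + q) N
  obtain ⟨C', hC', h'⟩ := exists_hasBound_fourier V N q
  refine ⟨C' * C, by positivity, fun a M k ha hb => ?_⟩
  have hl : ContDiff ℝ ∞ (localized a k) :=
    (ha.comp (contDiff_id.add contDiff_const)).mul contDiff_window
  exact (h' _ _ hl (h a M k ha hb)).mono le_rfl fun y => le_of_eq (by ring)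

/-- Smooth functions whose derivatives up to order `dim V + 1` grow at most linearly. -/
def LinearGrowth (F : V → ℂ) : Prop :=
  ContDiff ℝ ∞ F ∧ ∃ M, 0 ≤ M ∧ HasBound (finrank ℝ V + 1) (fun ζ => M * (1 + ‖ζ‖)) F

omit [FiniteDimensional ℝ V] [MeasurableSpace V] [BorelSpace V] in
lemma Nice.linearGrowth {F : V → ℂ} (hF : Nice 0 F) : LinearGrowth F := by
  obtain ⟨M, hM, hb⟩ := hF.bound (finrank ℝ V + 1)
  exact ⟨hF.1, M, hM, hb.mono le_rfl fun ζ => by nlinarith [norm_nonneg ζ]⟩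

variable (V) in
-- One derivative of `a` beyond `s` supplies the extra power of decay in ζ that absorbs the linear
-- growth of `F`.
lemma exists_hasBound_mul_fourier_localized (r s : ℕ) : ∃ C : ℝ, 0 ≤ C ∧
    ∀ (F a : V → ℂ) (M M' : ℝ) (k : V), ContDiff ℝ ∞ F → Nice 0 a →
    HasBound (finrank ℝ V + 1) (fun ζ => M * (1 + ‖ζ‖)) F →
    HasBound (s + 1) (fun y => M' * decay r y) a →
    HasBound (finrank ℝ V + 1) (fun ζ => C * M * M' * decay r k * decay s ζ)
      (fun ζ => F ζ * 𝓕 (localized a k) ζ) := by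
  obtain ⟨C, hC, h⟩ := exists_hasBound_fourier_localized V r (finrank ℝ V + 1) (s + 1)
  refine ⟨2 ^ (finrank ℝ V + 1) * C, by positivity, fun F a M M' k hF ha hbF hba => ?_⟩
  refine (hbF.mul hF (rapid_localized ha k).contDiff_fourier (h a M' k ha.1 hba)).mono le_rfl
    fun y => le_of_eq ?_
  simp only [decay, pow_succ]
  field_simp

lemma integrable_mul_fourier_localized {F a : V → ℂ} (hF : LinearGrowth F) (ha : Nice 0 a)
    (k : V) : Integrable (fun ζ => F ζ * 𝓕 (localized a k) ζ) := by
  obtain ⟨C, hC, h⟩ := exists_hasBound_mul_fourier_localized V 0 (finrank ℝ V + 1)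
  obtain ⟨hF, M, hM, hbF⟩ := hF
  obtain ⟨M', hM', hba⟩ := ha.2 (finrank ℝ V + 1 + 1)
  refine integrable_of_norm_le_decay ?_ (h F a M M' k hF ha hbF hba).norm_le
  exact (hF.continuous.mul (rapid_localized ha k).contDiff_fourier.continuous).aestronglyMeasurable

variable (V) in
-- This is why `pairing` converges: the finrank + 1 derivatives of `F` turn, under the outer Fourier
-- transform, into integrable decay in `k`, although `a` itself need not decay.
lemma exists_norm_integrand_le : ∃ C : ℝ, 0 ≤ C ∧
    ∀ (F a : V → ℂ) (M M' : ℝ), ContDiff ℝ ∞ F → Nice 0 a →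
    HasBound (finrank ℝ V + 1) (fun ζ => M * (1 + ‖ζ‖)) F →
    HasBound (finrank ℝ V + 2) (fun _ => M') a → ∀ k,
    ‖𝓕 (fun ζ => F ζ * 𝓕 (localized a k) ζ) k‖ ≤ C * M * M' * decay (finrank ℝ V + 1) k := by
  obtain ⟨C, hC, h⟩ := exists_hasBound_mul_fourier_localized V 0 (finrank ℝ V + 1)
  obtain ⟨C', hC', h'⟩ := exists_hasBound_fourier V (finrank ℝ V + 1) 0
  refine ⟨C' * C, by positivity, fun F a M M' hF ha hbF hba k => ?_⟩
  have := h F a M M' k hF ha hbF (by simpa using hba)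
  have := (h' _ _ (hF.mul (rapid_localized ha k).contDiff_fourier) this).norm_le k
  refine this.trans (le_of_eq ?_)
  rw [decay_zero]; ring

lemma stronglyMeasurable_fourier_localized {F a : V → ℂ} (hF : Continuous F)
    (ha : Continuous a) : StronglyMeasurable (fun p : V × V =>
      Real.fourierChar (-⟪p.2, p.1⟫) • (F p.2 * 𝓕 (localized a p.1) p.2)) := by
  have h1 : StronglyMeasurable (fun p : V × V => 𝓕 (localized a p.1) p.2) := by
    simp only [Real.fourier_eq, localized]
    apply StronglyMeasurable.integral_prod_right'
      (f := fun p : (V × V) × V =>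
        Real.fourierChar (-⟪p.2, p.1.2⟫) • (a (p.2 + p.1.1) * window p.2))
    apply Continuous.stronglyMeasurable
    have : Continuous (window : V → ℂ) := contDiff_window.continuous
    fun_prop
  simp only [Circle.smul_def, smul_eq_mul]
  refine StronglyMeasurable.mul ?_ (StronglyMeasurable.mul ?_ h1)
  · exact Continuous.stronglyMeasurable (by fun_prop)
  · exact Continuous.stronglyMeasurable (by fun_prop)

lemma stronglyMeasurable_integrand {F a : V → ℂ} (hF : Continuous F) (ha : Continuous a) :
    StronglyMeasurable (fun k : V => 𝓕 (fun ζ => F ζ * 𝓕 (localized a k) ζ) k) := by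
  have h := (stronglyMeasurable_fourier_localized hF ha).integral_prod_right' (ν := volume)
  convert h using 2 with k
  rw [Real.fourier_eq]

lemma integrable_integrand {F a : V → ℂ} (hF : LinearGrowth F) (ha : Nice 0 a) :
    Integrable (fun k : V => 𝓕 (fun ζ => F ζ * 𝓕 (localized a k) ζ) k) := by
  obtain ⟨C, hC, h⟩ := exists_norm_integrand_le V
  obtain ⟨hF, M, hM, hbF⟩ := hF
  obtain ⟨M', hM', hba⟩ := ha.bound (finrank ℝ V + 2)
  exact integrable_of_norm_le_decay
    (stronglyMeasurable_integrand hF.continuous ha.continuous).aestronglyMeasurable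
    (h F a M M' hF ha hbF hba)

variable (V) in
lemma exists_norm_pairing_le : ∃ K : ℝ, 0 ≤ K ∧
    ∀ (F a : V → ℂ) (M M' : ℝ), ContDiff ℝ ∞ F → Nice 0 a →
    HasBound (finrank ℝ V + 1) (fun ζ => M * (1 + ‖ζ‖)) F →
    HasBound (finrank ℝ V + 2) (fun _ => M') a → ‖pairing F a‖ ≤ K * M * M' := by
  obtain ⟨C, hC, h⟩ := exists_norm_integrand_le V
  refine ⟨C * ∫ v : V, decay (finrank ℝ V + 1) v,
    mul_nonneg hC (integral_nonneg fun v => (decay_pos _ _).le),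
    fun F a M M' hF ha hbF hba => ?_⟩
  refine (norm_integral_le_of_norm_le ((integrable_decay volume).const_mul (C * M * M'))
    (Eventually.of_forall (h F a M M' hF ha hbF hba))).trans (le_of_eq ?_)
  rw [integral_const_mul]; ring

lemma pairing_add_left {F F' a : V → ℂ} (hF : LinearGrowth F) (hF' : LinearGrowth F')
    (ha : Nice 0 a) : pairing (fun ζ => F ζ + F' ζ) a = pairing F a + pairing F' a := by
  unfold pairing
  rw [← integral_add (integrable_integrand hF ha) (integrable_integrand hF' ha)]
  refine integral_congr_ae (Eventually.of_forall fun k => ?_)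
  simp only [Real.fourier_eq, add_mul, smul_add]
  refine integral_add ?_ ?_
  · exact (Real.fourierIntegral_convergent_iff k).2 (integrable_mul_fourier_localized hF ha k)
  · exact (Real.fourierIntegral_convergent_iff k).2 (integrable_mul_fourier_localized hF' ha k)

lemma pairing_smul_left (t : ℂ) (F a : V → ℂ) :
    pairing (fun ζ => t * F ζ) a = t * pairing F a := by
  unfold pairing
  rw [← integral_const_mul]
  refine integral_congr_ae (Eventually.of_forall fun k => ?_)
  simp only [Real.fourier_eq]
  rw [← integral_const_mul]
  refine integral_congr_ae (Eventually.of_forall fun ζ => ?_)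
  simp only [Circle.smul_def, smul_eq_mul]
  ring

lemma fourier_localized_add {a a' : V → ℂ} (ha : Nice 0 a) (ha' : Nice 0 a') (k ζ : V) :
    𝓕 (localized (fun y => a y + a' y) k) ζ = 𝓕 (localized a k) ζ + 𝓕 (localized a' k) ζ := by
  simp only [Real.fourier_eq, localized, add_mul, smul_add]
  refine integral_add ?_ ?_
  · exact (Real.fourierIntegral_convergent_iff ζ).2 (rapid_localized ha k).integrable
  · exact (Real.fourierIntegral_convergent_iff ζ).2 (rapid_localized ha' k).integrable

lemma pairing_add_right {F a a' : V → ℂ} (hF : LinearGrowth F) (ha : Nice 0 a)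
    (ha' : Nice 0 a') : pairing F (fun y => a y + a' y) = pairing F a + pairing F a' := by
  unfold pairing
  rw [← integral_add (integrable_integrand hF ha) (integrable_integrand hF ha')]
  refine integral_congr_ae (Eventually.of_forall fun k => ?_)
  simp only [fourier_localized_add ha ha', mul_add]
  rw [Real.fourier_eq, Real.fourier_eq, Real.fourier_eq]
  simp only [smul_add]
  refine integral_add ?_ ?_
  · exact (Real.fourierIntegral_convergent_iff k).2 (integrable_mul_fourier_localized hF ha k)
  · exact (Real.fourierIntegral_convergent_iff k).2 (integrable_mul_fourier_localized hF ha' k)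

lemma pairing_smul_right (t : ℂ) (F a : V → ℂ) :
    pairing F (fun y => t * a y) = t * pairing F a := by
  rw [← pairing_smul_left]
  unfold pairing
  refine integral_congr_ae (Eventually.of_forall fun k => ?_)
  simp only
  refine congrArg (fun f : V → ℂ => 𝓕 f k) (funext fun ζ => ?_)
  rw [mul_comm t, mul_assoc]
  congr 1
  simp only [Real.fourier_eq, localized]
  rw [← integral_const_mul]
  refine integral_congr_ae (Eventually.of_forall fun ζ => ?_)
  simp only [Circle.smul_def, smul_eq_mul]
  ring

/-- Here the inner expression is a double Fourier transform, so at `k` it equals `localized a k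
(-k)`, that is `a 0 * window (-k)`; the window has integral one. -/
lemma pairing_const (c : ℂ) {a : V → ℂ} (ha : Nice 0 a) : pairing (fun _ => c) a = c * a 0 := by
  have h := pairing_smul_left c (fun _ : V => (1 : ℂ)) a
  simp only [mul_one] at h
  rw [h]
  congr 1
  unfold pairing
  simp only [one_mul]
  calc ∫ k : V, 𝓕 (fun ζ => 𝓕 (localized a k) ζ) k = ∫ k : V, a 0 * window (-k) := by
        refine integral_congr_ae (Eventually.of_forall fun k => ?_)
        simp only
        rw [show (fun ζ => 𝓕 (localized a k) ζ) = 𝓕 (localized a k) from rfl,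
          (rapid_localized ha k).fourier_fourier, localized, neg_add_cancel]
    _ = a 0 := by
        rw [integral_const_mul, integral_neg_eq_self (fun k : V => window k), integral_window,
          mul_one]

/-- Moving the piece back from the origin to `k` multiplies its transform by a character, precisely
the one in the outer Fourier transform of `pairing` at `k`. -/
lemma fourierChar_smul_fourier_localized (a : V → ℂ) (k ζ : V) :
    Real.fourierChar (-⟪ζ, k⟫) • 𝓕 (localized a k) ζ =
      𝓕 (fun w => a w * window (w - k)) ζ := by
  rw [Real.fourier_eq, Real.fourier_eq, Circle.smul_def, smul_eq_mul, ← integral_const_mul,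
    ← integral_add_right_eq_self (fun w => Real.fourierChar (-⟪w, ζ⟫) • (a w * window (w - k))) k]
  refine integral_congr_ae (Eventually.of_forall fun w => ?_)
  simp only [localized, add_sub_cancel_right]
  rw [← smul_eq_mul, ← Circle.smul_def, smul_smul, ← AddChar.map_add_eq_mul]
  congr 2
  rw [inner_add_left, real_inner_comm ζ k]
  ring

/-- The translates of the window form a continuous partition of unity: ∫ window(w - k) dk = 1. -/
lemma integral_fourier_window {a : V → ℂ} (ha : Rapid a) (ζ : V) :
    ∫ k, 𝓕 (fun w => a w * window (w - k)) ζ = 𝓕 a ζ := by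
  simp only [Real.fourier_eq]
  rw [integral_integral_swap]
  · refine integral_congr_ae (Eventually.of_forall fun w => ?_)
    simp only [Circle.smul_def, smul_eq_mul]
    rw [integral_const_mul, integral_const_mul, integral_sub_left_eq_self (fun k : V => window k),
      integral_window, mul_one]
  · have h := Integrable.convolution_integrand (ContinuousLinearMap.mul ℝ ℂ)
      (μ := (volume : Measure V)) (ν := (volume : Measure V)) ha.integrable
      (rapid_window (V := V)).integrable.comp_neg
    refine h.mono (Continuous.aestronglyMeasurable ?_) (Eventually.of_forall fun p => ?_)
    · have : Continuous (window : V → ℂ) := contDiff_window.continuous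
      have := (ha 0).continuous
      unfold Function.uncurry
      fun_prop
    · simp [Function.uncurry, Circle.norm_smul]

/-- Fubini applies because decay of `a` now yields joint integrability in (k, ζ); integrating over
`k` then reassembles `a` from its pieces. -/
lemma pairing_eq_integral {F a : V → ℂ} (hF : LinearGrowth F) (ha : Rapid a) :
    pairing F a = ∫ ζ, F ζ * 𝓕 a ζ := by
  unfold pairing
  simp only [Real.fourier_eq (fun ζ => F ζ * _)]
  rw [integral_integral_swap]
  · refine integral_congr_ae (Eventually.of_forall fun ζ => ?_)
    have e (k : V) : Real.fourierChar (-⟪ζ, k⟫) • (F ζ * 𝓕 (localized a k) ζ) =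
        F ζ * 𝓕 (fun w => a w * window (w - k)) ζ := by
      rw [← fourierChar_smul_fourier_localized, Circle.smul_def, Circle.smul_def]
      simp only [smul_eq_mul]
      ring
    simp only [e]
    rw [integral_const_mul, integral_fourier_window ha]
  · obtain ⟨C, hC, h⟩ := exists_hasBound_mul_fourier_localized V (finrank ℝ V + 1)
      (finrank ℝ V + 1)
    obtain ⟨hFs, M, hM, hbF⟩ := hF
    obtain ⟨M', hM', hba⟩ := (ha (finrank ℝ V + 1)).2 (finrank ℝ V + 1 + 1)
    refine (((integrable_decay (volume : Measure V)).const_mul (C * M * M')).mul_prod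
      (integrable_decay (volume : Measure V))).mono'
      (stronglyMeasurable_fourier_localized hFs.continuous
        (ha 0).continuous).aestronglyMeasurable (Eventually.of_forall fun p => ?_)
    have := (h F a M M' p.1 hFs (ha 0) hbF hba).norm_le p.2
    simpa [Function.uncurry, Circle.norm_smul] using this

/-- For fixed `k` the integrand sees only the values of the symbol within the window around `k`, so
it is eventually constant in `j`; the uniform derivative bounds give the dominating function. -/
lemma tendsto_pairing {F a : V → ℂ} {A : ℕ → V → ℂ} {M : ℝ} (hF : LinearGrowth F)
    (hA : ∀ j, Nice 0 (A j)) (hb : ∀ j, HasBound (finrank ℝ V + 2) (fun _ => M) (A j))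
    (hlim : ∀ R : ℝ, ∀ᶠ j in atTop, ∀ y, ‖y‖ ≤ R → A j y = a y) :
    Tendsto (fun j => pairing F (A j)) atTop (𝓝 (pairing F a)) := by
  obtain ⟨C, hC, h⟩ := exists_norm_integrand_le V
  have hF' := hF
  obtain ⟨hFs, M', hM', hbF⟩ := hF
  refine tendsto_integral_of_dominated_convergence
    (fun k => C * M' * M * decay (finrank ℝ V + 1) k)
    (fun j => (integrable_integrand hF' (hA j)).aestronglyMeasurable)
    ((integrable_decay volume).const_mul _) (fun j => Eventually.of_forall
      (h F (A j) M' M hFs (hA j) hbF (hb j))) (Eventually.of_forall fun k => ?_)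
  obtain ⟨R, hR⟩ := (hasCompactSupport_window (V := V)).isCompact.isBounded.exists_norm_le
  refine tendsto_const_nhds.congr' ?_
  filter_upwards [hlim (R + ‖k‖)] with j hj
  have : localized a k = localized (A j) k := by
    funext w
    simp only [localized]
    by_cases hw : w ∈ tsupport (window : V → ℂ)
    · rw [hj]
      exact (norm_add_le _ _).trans (by linarith [hR w hw])
    · rw [image_eq_zero_of_notMem_tsupport hw]; simp
  rw [this]

end Pairing

/-! ### The Moyal product and its first-order expansion -/

section Star

open Filter Topology Module

/-- The space of covectors `ζ = (p, q)` dual to phase space. -/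
abbrev Frequency (n : ℕ) : Type := WithLp 2 (Config n × Config n)

/-- The identification of the frequency space with phase space. -/
noncomputable def toPhase (n : ℕ) : Frequency n →L[ℝ] PhaseSpace n :=
  (WithLp.prodContinuousLinearEquiv 2 ℝ (Config n) (Config n) : Frequency n →L[ℝ] PhaseSpace n)

@[simp] lemma toPhase_apply {n : ℕ} (ζ : Frequency n) : toPhase n ζ = (ζ.fst, ζ.snd) := rfl

/-- The map `(p, q) ↦ (π q, -π p)`. -/
noncomputable def symplecticMap (n : ℕ) : Frequency n →L[ℝ] PhaseSpace n :=
  (Real.pi • (ContinuousLinearMap.snd ℝ (Config n) (Config n)).comp (toPhase n)).prod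
    (-Real.pi • (ContinuousLinearMap.fst ℝ (Config n) (Config n)).comp (toPhase n))

@[simp] lemma symplecticMap_apply {n : ℕ} (ζ : Frequency n) :
    symplecticMap n ζ = (Real.pi • ζ.snd, -Real.pi • ζ.fst) := rfl

/-- The Moyal product with parameter `h`, evaluated at the origin. -/
noncomputable def starForm {n : ℕ} (h : ℝ) (f g : PhaseSpace n → ℂ) : ℂ :=
  pairing (fun ζ => g ((h • symplecticMap n) ζ)) (fun w => f (toPhase n w))

/-- The Moyal product with parameter `h`. -/
noncomputable def star {n : ℕ} (h : ℝ) (f g : PhaseSpace n → ℂ) : PhaseSpace n → ℂ :=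
  BoundedForm.translated (starForm h) (ContinuousLinearMap.id ℝ _) (ContinuousLinearMap.id ℝ _) f g

/-- The factor `h` has two sources: at order zero the mean value inequality on a path of length at
most h‖L‖‖y‖, and at order p ≥ 1 the chain rule factor h^p ≤ h. -/
lemma hasBound_comp_sub_zero {E G : Type*} [NormedAddCommGroup E] [NormedSpace ℝ E]
    [NormedAddCommGroup G] [NormedSpace ℝ G] {g : E → ℂ} {N : ℕ} {M h : ℝ} (hg : ContDiff ℝ ∞ g)
    (hb : HasBound (N + 1) (fun _ => M) g) (h0 : 0 ≤ h) (h1 : h ≤ 1) (L : G →L[ℝ] E) :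
    HasBound N (fun y => h * ((max 1 ‖L‖) ^ (N + 1) * M) * (1 + ‖y‖))
      (fun y => g ((h • L) y) - g 0) := by
  have hM : 0 ≤ M := hb.nonneg 0
  have hL : ‖h • L‖ ≤ h * max 1 ‖L‖ := by
    rw [norm_smul, Real.norm_of_nonneg h0]
    gcongr; exact le_max_right _ _
  have one_le : 1 ≤ max 1 ‖L‖ := le_max_left _ _
  intro p hp y
  rcases Nat.eq_zero_or_pos p with rfl | hpos
  · rw [norm_iteratedFDeriv_zero]
    have := convex_univ.norm_image_sub_le_of_norm_fderiv_le (𝕜 := ℝ) (f := g) (C := M)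
      (fun z _ => hg.differentiable (by simp) z)
      (fun z _ => by simpa using hb 1 (by omega) z) (Set.mem_univ 0) (Set.mem_univ ((h • L) y))
    refine this.trans ?_
    rw [sub_zero]
    have h2 : ‖(h • L) y‖ ≤ h * max 1 ‖L‖ * ‖y‖ :=
      ((h • L).le_opNorm y).trans (mul_le_mul_of_nonneg_right hL (norm_nonneg _))
    calc _ ≤ M * (h * max 1 ‖L‖ * ‖y‖) := by gcongr
      _ ≤ M * (h * (max 1 ‖L‖) ^ (N + 1) * (1 + ‖y‖)) := by
        gcongr
        · exact le_self_pow₀ one_le (by omega)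
        · linarith
      _ = _ := by ring
  · have e := fun_iteratedFDeriv_sub_apply (𝕜 := ℝ) (f := fun y => g ((h • L) y))
      (g := fun _ => g 0) (i := p) (x := y)
      (((hg.comp (h • L).contDiff).of_le (by exact_mod_cast le_top)).contDiffAt)
      contDiffAt_const
    rw [e, iteratedFDeriv_const_of_ne (by omega), Pi.zero_apply, sub_zero]
    have e' := (h • L).iteratedFDeriv_comp_right (n := ∞) hg y (i := p) (by exact_mod_cast le_top)
    change ‖iteratedFDeriv ℝ p (g ∘ (h • L)) y‖ ≤ _
    rw [e']
    refine (ContinuousMultilinearMap.norm_compContinuousLinearMap_le _ _).trans ?_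
    rw [Finset.prod_const, Finset.card_univ, Fintype.card_fin]
    have h3 : ‖h • L‖ ^ p ≤ h * (max 1 ‖L‖) ^ (N + 1) := by
      calc ‖h • L‖ ^ p ≤ (h * max 1 ‖L‖) ^ p := by gcongr
        _ = h ^ p * (max 1 ‖L‖) ^ p := mul_pow _ _ _
        _ ≤ h * (max 1 ‖L‖) ^ (N + 1) :=
          mul_le_mul (pow_le_of_le_one h0 h1 (by omega)) (pow_le_pow_right₀ one_le (by omega))
            (by positivity) h0
    calc _ ≤ M * (h * (max 1 ‖L‖) ^ (N + 1)) :=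
          mul_le_mul (hb p (by omega) _) h3 (by positivity) hM
      _ ≤ M * (h * (max 1 ‖L‖) ^ (N + 1)) * (1 + ‖y‖) :=
          le_mul_of_one_le_right (by positivity) (by linarith [norm_nonneg y])
      _ = _ := by ring

/-- Pairing with the constant `g 0` gives exactly `f 0 * g 0`, so the leading term can be subtracted
inside the pairing. -/
lemma starForm_sub {n : ℕ} {f g : PhaseSpace n → ℂ} (hf : Nice 0 f) (hg : Nice 0 g) (h : ℝ) :
    starForm h f g - f 0 * g 0 =
      pairing (fun ζ => g ((h • symplecticMap n) ζ) - g 0) (fun w => f (toPhase n w)) := by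
  have e := pairing_add_left ((hg.comp_clm (h • symplecticMap n)).linearGrowth)
    (Nice.const (-(g 0))).linearGrowth (hf.comp_clm (toPhase n))
  rw [pairing_const _ (hf.comp_clm (toPhase n))] at e
  simp only [sub_eq_add_neg]
  rw [e, starForm, map_zero]
  ring

variable (n : ℕ) in
/-- The order of the `C^N` norms controlling the Moyal product. -/
noncomputable def starOrder : ℕ := finrank ℝ (Frequency n) + 2

lemma exists_norm_starForm_sub_le (n : ℕ) : ∃ K : ℝ, 0 ≤ K ∧
    ∀ (h M M' : ℝ) (f g : PhaseSpace n → ℂ), 0 ≤ h → h ≤ 1 → Nice 0 f → Nice 0 g →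
    HasBound (starOrder n) (fun _ => M) f → HasBound (starOrder n) (fun _ => M') g →
    ‖starForm h f g - f 0 * g 0‖ ≤ h * (K * M * M') := by
  obtain ⟨K, hK, hb⟩ := exists_norm_pairing_le (Frequency n)
  refine ⟨K * (max 1 ‖symplecticMap n‖) ^ (starOrder n) * (max 1 ‖toPhase n‖) ^ (starOrder n),
    by positivity, fun h M M' f g h0 h1 hf hg hbf hbg => ?_⟩
  rw [starForm_sub hf hg]
  have b1 := hasBound_comp_sub_zero hg.1 hbg h0 h1 (symplecticMap n)
  have b2 := hbf.comp_clm hf.1 (toPhase n)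
  refine (hb _ _ _ _ ((hg.comp_clm (h • symplecticMap n)).1.sub contDiff_const)
    (hf.comp_clm _) b1 b2).trans (le_of_eq ?_)
  unfold starOrder
  ring

lemma exists_norm_starForm_le (n : ℕ) : ∃ K : ℝ, 0 ≤ K ∧
    ∀ (h M M' : ℝ) (f g : PhaseSpace n → ℂ), 0 ≤ h → h ≤ 1 → Nice 0 f → Nice 0 g →
    HasBound (starOrder n) (fun _ => M) f → HasBound (starOrder n) (fun _ => M') g →
    ‖starForm h f g‖ ≤ K * M * M' := by
  obtain ⟨K, hK, hb⟩ := exists_norm_starForm_sub_le n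
  refine ⟨K + 1, by positivity, fun h M M' f g h0 h1 hf hg hbf hbg => ?_⟩
  have h2 := hb h M M' f g h0 h1 hf hg hbf hbg
  have hM : 0 ≤ M := hbf.nonneg 0
  have hM' : 0 ≤ M' := hbg.nonneg 0
  have h3 : ‖f 0 * g 0‖ ≤ M * M' := by
    rw [norm_mul]
    exact mul_le_mul (hbf.norm_le 0) (hbg.norm_le 0) (norm_nonneg _) hM
  have h4 : h * (K * M * M') ≤ K * M * M' := mul_le_of_le_one_left (by positivity) h1
  calc ‖starForm h f g‖ = ‖(starForm h f g - f 0 * g 0) + f 0 * g 0‖ := by rw [sub_add_cancel]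
    _ ≤ K * M * M' + M * M' := (norm_add_le _ _).trans (add_le_add (h2.trans h4) h3)
    _ = _ := by ring

variable {n : ℕ} {h : ℝ}

lemma boundedForm_starForm (h0 : 0 ≤ h) (h1 : h ≤ 1) :
    BoundedForm 0 0 (starForm h : (PhaseSpace n → ℂ) → (PhaseSpace n → ℂ) → ℂ) where
  add_left f f' g hf hf' hg := pairing_add_right (hg.comp_clm (h • symplecticMap n)).linearGrowth
    (hf.comp_clm (toPhase n)) (hf'.comp_clm (toPhase n))
  smul_left t f g hf hg := pairing_smul_right t _ _
  add_right f g g' hf hg hg' := pairing_add_left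
    (hg.comp_clm (h • symplecticMap n)).linearGrowth
    (hg'.comp_clm (h • symplecticMap n)).linearGrowth (hf.comp_clm (toPhase n))
  smul_right t f g hf hg := pairing_smul_left t _ _
  bound := by
    obtain ⟨K, hK, hb⟩ := exists_norm_starForm_le n
    exact ⟨K, starOrder n, hK, fun f g M M' hf hg _ _ hbf hbg =>
      hb h M M' f g h0 h1 hf hg (by simpa using hbf) (by simpa using hbg)⟩

lemma contDiff_star (h0 : 0 ≤ h) (h1 : h ≤ 1) {f g : PhaseSpace n → ℂ} (hf : Nice 0 f)
    (hg : Nice 0 g) : ContDiff ℝ ∞ (star h f g) :=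
  (boundedForm_starForm h0 h1).contDiff_translated _ _ hf hg

lemma fderiv_star (h0 : 0 ≤ h) (h1 : h ≤ 1) {f g : PhaseSpace n → ℂ} (hf : Nice 0 f)
    (hg : Nice 0 g) (z v : PhaseSpace n) :
    fderiv ℝ (star h f g) z v =
      star h (fun y => fderiv ℝ f y v) g z + star h f (fun y => fderiv ℝ g y v) z :=
  (boundedForm_starForm h0 h1).fderiv_translated _ _ hf hg z v

/-- The bounds at the origin transfer to every point because constant weights do not change under
translation. -/
lemma exists_norm_star_le (n : ℕ) : ∃ K : ℝ, 0 ≤ K ∧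
    ∀ (h M M' : ℝ) (f g : PhaseSpace n → ℂ), 0 ≤ h → h ≤ 1 → Nice 0 f → Nice 0 g →
    HasBound (starOrder n) (fun _ => M) f → HasBound (starOrder n) (fun _ => M') g →
    ∀ z, ‖star h f g z‖ ≤ K * M * M' ∧ ‖star h f g z - f z * g z‖ ≤ h * (K * M * M') := by
  obtain ⟨K, hK, hb⟩ := exists_norm_starForm_le n
  obtain ⟨K', hK', hb'⟩ := exists_norm_starForm_sub_le n
  refine ⟨K + K', by positivity, fun h M M' f g h0 h1 hf hg hbf hbg z => ⟨?_, ?_⟩⟩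
  all_goals
    have hM : 0 ≤ M := hbf.nonneg 0
    have hM' : 0 ≤ M' := hbg.nonneg 0
  · refine (hb h M M' _ _ h0 h1 (hf.translate z) (hg.translate z) (hbf.translate z)
      (hbg.translate z)).trans ?_
    gcongr
    linarith
  · have := hb' h M M' _ _ h0 h1 (hf.translate z) (hg.translate z) (hbf.translate z)
      (hbg.translate z)
    simp only [zero_add] at this
    refine this.trans ?_
    gcongr
    linarith

end Star

/-! ### Gevrey estimates for products obeying the Leibniz rule -/

section Gevrey

open Filter Topology Module

variable {n : ℕ}

/-- Multi-indices are encoded below as lists of directions compared by `List.count`; the counting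
lemmas ask for a lawful Boolean equality. -/
instance : LawfulBEq (Fin n ⊕ Fin n) where
  rfl := by
    rintro (i | i)
    · exact beq_self_eq_true i
    · exact beq_self_eq_true i
  eq_of_beq := by
    rintro (i | i) (j | j) h
    · exact congrArg _ (eq_of_beq (α := Fin n) h)
    · exact absurd h Bool.false_ne_true
    · exact absurd h Bool.false_ne_true
    · exact congrArg _ (eq_of_beq (α := Fin n) h)

/-- The standard basis of phase space. -/
noncomputable def basisVec (n : ℕ) : Fin n ⊕ Fin n → PhaseSpace n :=
  Sum.elim (fun i => (EuclideanSpace.single i (1 : ℝ), 0))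
    (fun i => (0, EuclideanSpace.single i (1 : ℝ)))

/-- The coordinate functionals of the standard basis of phase space. -/
noncomputable def coordFun (n : ℕ) : Fin n ⊕ Fin n → PhaseSpace n →L[ℝ] ℝ :=
  Sum.elim (fun i => (EuclideanSpace.proj i).comp (ContinuousLinearMap.fst ℝ _ _))
    (fun i => (EuclideanSpace.proj i).comp (ContinuousLinearMap.snd ℝ _ _))

lemma sum_coordFun_smul (v : PhaseSpace n) : ∑ j, coordFun n j v • basisVec n j = v := by
  simp only [Fintype.sum_sum_type, coordFun, basisVec, Sum.elim_inl, Sum.elim_inr]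
  have h (w : Config n) : ∑ i, w i • (EuclideanSpace.single i (1 : ℝ) : Config n) = w := by
    ext k
    simp [Pi.single_apply]
  ext k <;> simp [Prod.fst_sum, Prod.snd_sum, Pi.single_apply]

/-- Iterated derivatives along a list of basis directions. -/
noncomputable def listDeriv : List (Fin n ⊕ Fin n) → (PhaseSpace n → ℂ) → PhaseSpace n → ℂ
  | [], f => f
  | j :: L, f => listDeriv L (dirDeriv (basisVec n j) f)

lemma listDeriv_append (L L' : List (Fin n ⊕ Fin n)) (f : PhaseSpace n → ℂ) :
    listDeriv (L ++ L') f = listDeriv L' (listDeriv L f) := by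
  induction L generalizing f with
  | nil => rfl
  | cons j L ih => exact ih _

lemma contDiff_dirDeriv {f : PhaseSpace n → ℂ} (hf : ContDiff ℝ ∞ f) (v : PhaseSpace n) :
    ContDiff ℝ ∞ (dirDeriv v f) :=
  (hf.fderiv_right (m := ∞) (by simp)).clm_apply contDiff_const

lemma contDiff_listDeriv {f : PhaseSpace n → ℂ} (hf : ContDiff ℝ ∞ f)
    (L : List (Fin n ⊕ Fin n)) : ContDiff ℝ ∞ (listDeriv L f) := by
  induction L generalizing f with
  | nil => exact hf
  | cons j L ih => exact ih (contDiff_dirDeriv hf _)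

lemma Nice.listDeriv {f : PhaseSpace n → ℂ} (hf : Nice 0 f)
    (L : List (Fin n ⊕ Fin n)) : Nice 0 (listDeriv L f) := by
  induction L generalizing f with
  | nil => exact hf
  | cons j L ih => exact ih (hf.fderiv_apply _)

lemma listDeriv_add {f g : PhaseSpace n → ℂ} (hf : ContDiff ℝ ∞ f) (hg : ContDiff ℝ ∞ g)
    (L : List (Fin n ⊕ Fin n)) (z : PhaseSpace n) :
    listDeriv L (fun y => f y + g y) z = listDeriv L f z + listDeriv L g z := by
  induction L generalizing f g with
  | nil => rfl
  | cons j L ih =>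
    simp only [listDeriv]
    rw [← ih (contDiff_dirDeriv hf _) (contDiff_dirDeriv hg _)]
    congr 1
    funext y
    simp only [dirDeriv]
    rw [fderiv_fun_add (hf.differentiable (by simp) y) (hg.differentiable (by simp) y)]
    rfl

lemma dirDeriv_comm {f : PhaseSpace n → ℂ} (hf : ContDiff ℝ ∞ f) (v w : PhaseSpace n) :
    dirDeriv v (dirDeriv w f) = dirDeriv w (dirDeriv v f) :=
  funext fun y => fderiv_fderiv_apply_comm (contDiff_infty.1 hf 2) y w v

/-- Since derivatives commute, a list of directions carries no more information than its
multiplicities, that is, than the pair (α, β). -/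
lemma listDeriv_perm {L L' : List (Fin n ⊕ Fin n)} (h : L.Perm L') {f : PhaseSpace n → ℂ}
    (hf : ContDiff ℝ ∞ f) : listDeriv L f = listDeriv L' f := by
  induction h generalizing f with
  | nil => rfl
  | cons j _ ih => exact ih (contDiff_dirDeriv hf _)
  | swap i j L => simp only [listDeriv]; rw [dirDeriv_comm hf]
  | trans _ _ ih ih' => exact (ih hf).trans (ih' hf)

lemma listDeriv_replicate (k : ℕ) (j : Fin n ⊕ Fin n) (f : PhaseSpace n → ℂ) :
    listDeriv (List.replicate k j) f = (dirDeriv (basisVec n j))^[k] f := by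
  induction k generalizing f with
  | zero => rfl
  | succ k ih => rw [List.replicate_succ, listDeriv, ih, Function.iterate_succ_apply]

/-- The list of directions of `iterDeriv`. -/
def multiList (ι : Fin n → Fin n ⊕ Fin n) (α : Fin n → ℕ) (l : List (Fin n)) :
    List (Fin n ⊕ Fin n) :=
  l.foldr (fun i L => L ++ List.replicate (α i) (ι i)) []

lemma listDeriv_multiList (ι : Fin n → Fin n ⊕ Fin n) (α : Fin n → ℕ) (f : PhaseSpace n → ℂ) :
    listDeriv (multiList ι α (List.finRange n)) f =
      iterDeriv (fun i => basisVec n (ι i)) α f := by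
  unfold iterDeriv multiList
  induction List.finRange n with
  | nil => rfl
  | cons i l ih => rw [List.foldr_cons, listDeriv_append, ih, listDeriv_replicate, List.foldr_cons]

lemma count_multiList {ι : Fin n → Fin n ⊕ Fin n} (hι : Function.Injective ι) (α : Fin n → ℕ)
    (i : Fin n) : (multiList ι α (List.finRange n)).count (ι i) = α i := by
  have h (l : List (Fin n)) : (multiList ι α l).count (ι i) = l.count i * α i := by
    unfold multiList
    induction l with
    | nil => simp
    | cons k l ih =>
      rw [List.foldr_cons, List.count_append, ih, List.count_replicate, List.count_cons]
      by_cases hk : k = i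
      · subst hk; simp; ring
      · simp [hk, hι.eq_iff]
  rw [h, List.count_eq_one_of_mem (List.nodup_finRange n) (List.mem_finRange i), one_mul]

lemma count_multiList_of_ne {ι : Fin n → Fin n ⊕ Fin n} (α : Fin n → ℕ)
    {j : Fin n ⊕ Fin n} (hj : ∀ i, ι i ≠ j) :
    (multiList ι α (List.finRange n)).count j = 0 := by
  unfold multiList
  induction List.finRange n with
  | nil => simp
  | cons k l ih =>
    rw [List.foldr_cons, List.count_append, ih, List.count_replicate]
    simp [hj k]

lemma partialX_partialTheta (α β : Fin n → ℕ) (f : PhaseSpace n → ℂ) :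
    partialX α (partialTheta β f) =
      listDeriv (multiList Sum.inr β (List.finRange n) ++ multiList Sum.inl α (List.finRange n))
        f := by
  rw [listDeriv_append, listDeriv_multiList, listDeriv_multiList]
  rfl

/-- The product of the factorials of the multiplicities of the entries of `L`. -/
def listFactorial (L : List (Fin n ⊕ Fin n)) : ℕ := ∏ j, (L.count j).factorial

lemma sum_count_eq_length (L : List (Fin n ⊕ Fin n)) : ∑ j, L.count j = L.length := by
  induction L with
  | nil => simp
  | cons i L ih =>
    simp only [List.count_cons, Finset.sum_add_distrib, ih, List.length_cons, beq_iff_eq]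
    simp

lemma listFactorial_mul_le (L L' : List (Fin n ⊕ Fin n)) :
    listFactorial L * listFactorial L' ≤ listFactorial (L ++ L') := by
  unfold listFactorial
  rw [← Finset.prod_mul_distrib]
  refine Finset.prod_le_prod' fun j _ => ?_
  rw [List.count_append]
  exact Nat.le_of_dvd (Nat.factorial_pos _) (Nat.factorial_mul_factorial_dvd_factorial_add _ _)

/-- In each direction the quotient of factorials is a binomial coefficient, at most two to the total
multiplicity. -/
lemma listFactorial_append_le (L L' : List (Fin n ⊕ Fin n)) :
    listFactorial (L ++ L') ≤
      2 ^ (L.length + L'.length) * (listFactorial L * listFactorial L') := by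
  have h : L.length + L'.length = ∑ j, (L ++ L').count j := by
    rw [sum_count_eq_length, List.length_append]
  unfold listFactorial
  rw [h, ← Finset.prod_pow_eq_pow_sum, ← Finset.prod_mul_distrib, ← Finset.prod_mul_distrib]
  refine Finset.prod_le_prod' fun j _ => ?_
  rw [List.count_append, ← Nat.add_choose_mul_factorial_mul_factorial, mul_assoc]
  exact Nat.mul_le_mul_right _ (Nat.choose_le_two_pow _ _)

lemma listFactorial_le (L : List (Fin n ⊕ Fin n)) : listFactorial L ≤ L.length.factorial := by
  rw [← sum_count_eq_length]
  exact Nat.le_of_dvd (Nat.factorial_pos _) (Nat.prod_factorial_dvd_factorial_sum _ _)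

lemma listFactorial_perm {L L' : List (Fin n ⊕ Fin n)} (h : L.Perm L') :
    listFactorial L = listFactorial L' :=
  Finset.prod_congr rfl fun j _ => by rw [h.count_eq]

/-- The Gevrey estimates in terms of lists of directions. -/
def ListGevrey (s C : ℝ) (f : PhaseSpace n → ℂ) : Prop :=
  ContDiff ℝ ∞ f ∧ ∀ L p, ‖listDeriv L f p‖ ≤ C ^ (1 + L.length) * (listFactorial L : ℝ) ^ s

/-- Lists suit the Leibniz rule, which handles one direction at a time. The constant `C` is
unchanged because lengths and multiplicities reproduce orders and factorials exactly. -/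
lemma gevreyBound_iff_listGevrey {s C : ℝ} {f : PhaseSpace n → ℂ} :
    GevreyBound s C f ↔ ListGevrey s C f := by
  have aux (α β : Fin n → ℕ) (L : List (Fin n ⊕ Fin n)) (h1 : ∀ i, L.count (Sum.inl i) = α i)
      (h2 : ∀ i, L.count (Sum.inr i) = β i) :
      C ^ (1 + multiOrder α + multiOrder β) *
          ((multiFactorial α : ℝ) ^ s * (multiFactorial β : ℝ) ^ s) =
        C ^ (1 + L.length) * (listFactorial L : ℝ) ^ s := by
    rw [← Real.mul_rpow (by positivity) (by positivity), ← Nat.cast_mul, ← sum_count_eq_length L]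
    simp only [multiOrder, multiFactorial, listFactorial, Fintype.sum_sum_type,
      Fintype.prod_sum_type, h1, h2, add_assoc]
  have cl (α β : Fin n → ℕ) (i : Fin n) :
      (multiList Sum.inr β (List.finRange n) ++ multiList Sum.inl α (List.finRange n)).count
        (Sum.inl i) = α i := by
    rw [List.count_append, count_multiList_of_ne β (by simp),
      count_multiList Sum.inl_injective, zero_add]
  have cr (α β : Fin n → ℕ) (i : Fin n) :
      (multiList Sum.inr β (List.finRange n) ++ multiList Sum.inl α (List.finRange n)).count
        (Sum.inr i) = β i := by
    rw [List.count_append, count_multiList_of_ne α (by simp),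
      count_multiList Sum.inr_injective, add_zero]
  refine and_congr_right fun hf => ⟨fun h L p => ?_, fun h α β p => ?_⟩
  · have := h (fun i => L.count (Sum.inl i)) (fun i => L.count (Sum.inr i)) p
    rw [partialX_partialTheta, aux _ _ L (fun _ => rfl) (fun _ => rfl)] at this
    rwa [listDeriv_perm (List.perm_iff_count.2 ?_) hf] at this
    rintro (i | i)
    · rw [cl]
    · rw [cr]
  · rw [partialX_partialTheta, aux α β _ (cl α β) (cr α β)]
    exact h _ p

lemma ListGevrey.mono {s C C' : ℝ} {f : PhaseSpace n → ℂ} (h : ListGevrey s C f) (h0 : 0 ≤ C)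
    (hC : C ≤ C') : ListGevrey s C' f :=
  ⟨h.1, fun L p => (h.2 L p).trans (by gcongr)⟩

lemma fderiv_eq_sum_dirDeriv (F : PhaseSpace n → ℂ) (z : PhaseSpace n) :
    fderiv ℝ F z = ∑ j, ContinuousLinearMap.smulRightL ℝ (PhaseSpace n) ℂ (coordFun n j)
      (dirDeriv (basisVec n j) F z) := by
  refine ContinuousLinearMap.ext fun v => ?_
  conv_lhs => rw [← sum_coordFun_smul v]
  simp [dirDeriv]

variable (n) in
-- Expanding the derivative in the standard basis, one order at a time, compares operator norms of
-- iterated derivatives with partial derivatives.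
lemma exists_hasBound_of_listDeriv (N : ℕ) : ∃ K : ℝ, 0 ≤ K ∧ ∀ (F : PhaseSpace n → ℂ) (M : ℝ),
    ContDiff ℝ ∞ F → (∀ L : List (Fin n ⊕ Fin n), L.length ≤ N → ∀ z, ‖listDeriv L F z‖ ≤ M) →
    HasBound N (fun _ => K * M) F := by
  have key (p : ℕ) : ∃ K : ℝ, 0 ≤ K ∧ ∀ (F : PhaseSpace n → ℂ) (M : ℝ), ContDiff ℝ ∞ F →
      (∀ L : List (Fin n ⊕ Fin n), L.length ≤ p → ∀ z, ‖listDeriv L F z‖ ≤ M) →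
      ∀ z, ‖iteratedFDeriv ℝ p F z‖ ≤ K * M := by
    induction p with
    | zero =>
      refine ⟨1, zero_le_one, fun F M _ h z => ?_⟩
      simpa [listDeriv] using h [] le_rfl z
    | succ p ih =>
      obtain ⟨K, hK, ih⟩ := ih
      set T := fun j => ContinuousLinearMap.smulRightL ℝ (PhaseSpace n) ℂ (coordFun n j) with hT
      refine ⟨∑ j, ‖T j‖ * K, Finset.sum_nonneg fun j _ => by positivity, fun F M hF h z => ?_⟩
      rw [← norm_iteratedFDeriv_fderiv]
      have hj (j : Fin n ⊕ Fin n) : ContDiff ℝ ∞ (dirDeriv (basisVec n j) F) :=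
        contDiff_dirDeriv hF _
      have e : fderiv ℝ F = fun z => ∑ j, T j (dirDeriv (basisVec n j) F z) :=
        funext fun z => fderiv_eq_sum_dirDeriv F z
      rw [e, iteratedFDeriv_fun_sum_apply (f := fun j z => T j (dirDeriv (basisVec n j) F z))
        (fun j _ => (((T j).contDiff.comp (hj j)).of_le
        (by exact_mod_cast le_top)).contDiffAt), Finset.sum_mul]
      refine (norm_sum_le _ _).trans (Finset.sum_le_sum fun j _ => ?_)
      refine ((T j).norm_iteratedFDeriv_comp_left ((hj j).contDiffAt (n := ∞))
        (by exact_mod_cast le_top)).trans ?_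
      rw [mul_assoc]
      refine mul_le_mul_of_nonneg_left (ih _ M (hj j) (fun L hL z => ?_) z) (norm_nonneg _)
      exact h (j :: L) (by simpa using hL) z
  choose K hK h using key
  refine ⟨∑ p ∈ Finset.range (N + 1), K p, Finset.sum_nonneg fun p _ => hK p,
    fun F M hF hL p hp z => ?_⟩
  have hM : 0 ≤ M := (norm_nonneg _).trans (hL [] (Nat.zero_le _) 0)
  refine (h p F M hF (fun L hLp => hL L (hLp.trans hp)) z).trans ?_
  exact mul_le_mul_of_nonneg_right
    (Finset.single_le_sum (f := K) (fun p _ => hK p) (Finset.mem_range.2 (by omega))) hM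

/-- A bilinear product on functions with bounded derivatives which obeys the Leibniz rule and is
bounded for the `C^N` norms. -/
structure LeibnizProduct (K : ℝ) (N : ℕ)
    (T : (PhaseSpace n → ℂ) → (PhaseSpace n → ℂ) → PhaseSpace n → ℂ) : Prop where
  contDiff : ∀ f g, Nice 0 f → Nice 0 g → ContDiff ℝ ∞ (T f g)
  leibniz : ∀ f g v, Nice 0 f → Nice 0 g → ∀ z,
    dirDeriv v (T f g) z = T (dirDeriv v f) g z + T f (dirDeriv v g) z
  bound : ∀ f g M M', Nice 0 f → Nice 0 g → HasBound N (fun _ => M) f →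
    HasBound N (fun _ => M') g → ∀ z, ‖T f g z‖ ≤ K * M * M'

namespace LeibnizProduct

variable {K : ℝ} {N : ℕ} {T : (PhaseSpace n → ℂ) → (PhaseSpace n → ℂ) → PhaseSpace n → ℂ}

/-- Each direction of `L` falls on either factor, giving 2^|L| terms indexed by the splittings of
`L` into two lists. -/
lemma norm_listDeriv_le (hT : LeibnizProduct K N T) (L : List (Fin n ⊕ Fin n))
    {f g : PhaseSpace n → ℂ} (hf : Nice 0 f) (hg : Nice 0 g) {M : ℝ}
    (h : ∀ L₁ L₂, (L₁ ++ L₂).Perm L → ∀ z, ‖T (listDeriv L₁ f) (listDeriv L₂ g) z‖ ≤ M)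
    (z : PhaseSpace n) : ‖listDeriv L (T f g) z‖ ≤ 2 ^ L.length * M := by
  induction L generalizing f g with
  | nil => simpa [listDeriv] using h [] [] (List.Perm.refl _) z
  | cons j L ih =>
    have hf' : Nice 0 (dirDeriv (basisVec n j) f) := hf.fderiv_apply _
    have hg' : Nice 0 (dirDeriv (basisVec n j) g) := hg.fderiv_apply _
    have e : listDeriv (j :: L) (T f g) z = listDeriv L (T (dirDeriv (basisVec n j) f) g) z +
        listDeriv L (T f (dirDeriv (basisVec n j) g)) z := by
      rw [← listDeriv_add (hT.contDiff _ _ hf' hg) (hT.contDiff _ _ hf hg'), listDeriv]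
      congr 1
      exact funext fun y => hT.leibniz f g _ hf hg y
    have b1 := ih hf' hg (fun L₁ L₂ hp z => h (j :: L₁) L₂ (hp.cons j) z)
    have b2 := ih hf hg' (fun L₁ L₂ hp z => h L₁ (j :: L₂)
      (List.perm_middle.trans (hp.cons j)) z)
    rw [e, List.length_cons]
    refine (norm_add_le _ _).trans ((add_le_add b1 b2).trans (le_of_eq ?_))
    ring

end LeibnizProduct

/-- Up to `N` further derivatives cost a fixed constant and, through the factorial of the
concatenated list, a factor (2^s)^|L|. The growth thus stays geometric and the exponent `s` is
preserved. -/
lemma ListGevrey.exists_hasBound_listDeriv {s C : ℝ} (hs : 0 ≤ s) (hC : 1 ≤ C) (n N : ℕ) :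
    ∃ A : ℝ, 0 ≤ A ∧ ∀ f : PhaseSpace n → ℂ, ListGevrey s C f → ∀ L,
      HasBound N (fun _ => A * (C * 2 ^ s) ^ L.length * (listFactorial L : ℝ) ^ s)
        (listDeriv L f) := by
  obtain ⟨K, hK, h⟩ := exists_hasBound_of_listDeriv n N
  refine ⟨K * (C ^ (1 + N) * (2 ^ N * N.factorial : ℝ) ^ s), by positivity, fun f hf L => ?_⟩
  refine (h (listDeriv L f) (C ^ (1 + L.length + N) *
    (2 ^ (L.length + N) * N.factorial * listFactorial L : ℝ) ^ s) (contDiff_listDeriv hf.1 L)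
    fun Q hQ z => ?_).mono le_rfl fun _ => le_of_eq ?_
  · rw [← listDeriv_append]
    refine (hf.2 _ z).trans ?_
    rw [List.length_append]
    refine mul_le_mul (pow_le_pow_right₀ hC (by omega)) ?_ (by positivity) (by positivity)
    refine Real.rpow_le_rpow (by positivity) ?_ hs
    have h1 := listFactorial_append_le L Q
    have h2 : listFactorial Q ≤ N.factorial :=
      (listFactorial_le Q).trans (Nat.factorial_le hQ)
    have h3 : listFactorial (L ++ Q) ≤ 2 ^ (L.length + N) * N.factorial * listFactorial L := by
      calc _ ≤ _ := h1
        _ ≤ 2 ^ (L.length + N) * (listFactorial L * N.factorial) := by gcongr; norm_num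
        _ = _ := by ring
    exact_mod_cast h3
  · have e : (2 ^ (L.length + N) * N.factorial * listFactorial L : ℝ) ^ s =
        (2 ^ N * N.factorial : ℝ) ^ s * ((2 : ℝ) ^ s) ^ L.length * (listFactorial L : ℝ) ^ s := by
      rw [← Real.rpow_natCast ((2 : ℝ) ^ s), ← Real.rpow_mul (by norm_num), mul_comm s,
        Real.rpow_mul (by norm_num), Real.rpow_natCast, ← Real.mul_rpow (by positivity)
        (by positivity), ← Real.mul_rpow (by positivity) (by positivity)]
      congr 1
      ring
    rw [e, mul_pow]
    ring

lemma ListGevrey.nice {s C : ℝ} (hs : 0 ≤ s) {f : PhaseSpace n → ℂ} (hC : 0 ≤ C)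
    (hf : ListGevrey s C f) : Nice 0 f := by
  refine ⟨hf.1, fun N => ?_⟩
  -- Enlarging `C` to `C + 1` secures the lower bound 1 on the constant.
  obtain ⟨A, hA, h⟩ := ListGevrey.exists_hasBound_listDeriv (C := C + 1) hs (by linarith) n N
  have := h f (hf.mono hC (by linarith)) []
  exact ⟨_, this.nonneg 0, by simpa [listDeriv] using this⟩

/-- A product obeying the Leibniz rule maps Gevrey functions to Gevrey functions, with a constant
that depends only on the bound of the product. -/
lemma LeibnizProduct.exists_listGevrey {s C K : ℝ} (hs : 0 ≤ s) (hC : 1 ≤ C) (hK : 0 ≤ K)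
    (n N : ℕ) : ∃ C' : ℝ, 0 < C' ∧
      ∀ (T : (PhaseSpace n → ℂ) → (PhaseSpace n → ℂ) → PhaseSpace n → ℂ) (f g : PhaseSpace n → ℂ),
      LeibnizProduct K N T → ListGevrey s C f → ListGevrey s C g → ListGevrey s C' (T f g) := by
  obtain ⟨A, hA, h⟩ := ListGevrey.exists_hasBound_listDeriv hs hC n N
  set B : ℝ := 2 * (C * 2 ^ s)
  -- `B` includes the 2 from the number of Leibniz terms. The prefactor `K * A * A` is absorbed by
  -- the one extra power in the exponent 1 + |L|.
  refine ⟨K * A * A + B + 1, by positivity, fun T f g hT hf hg => ?_⟩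
  have nf := hf.nice hs (by linarith)
  have ng := hg.nice hs (by linarith)
  refine ⟨hT.contDiff _ _ nf ng, fun L z => ?_⟩
  refine (hT.norm_listDeriv_le L nf ng (M := K * A * A * (C * 2 ^ s) ^ L.length *
    (listFactorial L : ℝ) ^ s) (fun L₁ L₂ hp z => ?_) z).trans ?_
  · refine (hT.bound _ _ _ _ (nf.listDeriv L₁) (ng.listDeriv L₂) (h f hf L₁) (h g hg L₂)
      z).trans ?_
    have e1 : L.length = L₁.length + L₂.length := by
      rw [← hp.length_eq, List.length_append]
    have e2 : (listFactorial L₁ : ℝ) ^ s * (listFactorial L₂ : ℝ) ^ s ≤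
        (listFactorial L : ℝ) ^ s := by
      rw [← Real.mul_rpow (by positivity) (by positivity), ← listFactorial_perm hp]
      exact Real.rpow_le_rpow (by positivity) (by exact_mod_cast listFactorial_mul_le L₁ L₂) hs
    calc _ = K * A * A * (C * 2 ^ s) ^ L.length *
          ((listFactorial L₁ : ℝ) ^ s * (listFactorial L₂ : ℝ) ^ s) := by rw [e1, pow_add]; ring
      _ ≤ _ := by gcongr
  · have hB : 0 ≤ B := by positivity
    have hA' : 0 ≤ K * A * A := by positivity
    calc _ = K * A * A * B ^ L.length * (listFactorial L : ℝ) ^ s := by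
          simp only [B, mul_pow]; ring
      _ ≤ (K * A * A + B + 1) * (K * A * A + B + 1) ^ L.length * (listFactorial L : ℝ) ^ s := by
          gcongr <;> linarith
      _ = _ := by rw [pow_add, pow_one]

lemma norm_basisVec_le (j : Fin n ⊕ Fin n) : ‖basisVec n j‖ ≤ 1 := by
  rcases j with i | i <;> simp [basisVec, Prod.norm_def]

lemma HasBound.listDeriv {N : ℕ} {w : PhaseSpace n → ℝ} {f : PhaseSpace n → ℂ}
    (hf : ContDiff ℝ ∞ f) (L : List (Fin n ⊕ Fin n)) (h : HasBound (N + L.length) w f) :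
    HasBound N w (listDeriv L f) := by
  induction L generalizing f with
  | nil => exact h
  | cons j L ih =>
    refine ih (contDiff_dirDeriv hf _) ((HasBound.fderiv_apply hf h _).mono le_rfl fun y => ?_)
    exact mul_le_of_le_one_left (h.nonneg y) (norm_basisVec_le j)

/-- The constant does not depend on `T`, `f` or `g`; this keeps ⋆ bounded uniformly along the
cutoffs of a symbol. -/
lemma LeibnizProduct.exists_hasBound {K : ℝ} (hK : 0 ≤ K) (n N P : ℕ) : ∃ K' : ℝ, 0 ≤ K' ∧
    ∀ (T : (PhaseSpace n → ℂ) → (PhaseSpace n → ℂ) → PhaseSpace n → ℂ) (f g : PhaseSpace n → ℂ)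
      (M M' : ℝ), LeibnizProduct K N T → Nice 0 f → Nice 0 g → HasBound (N + P) (fun _ => M) f →
      HasBound (N + P) (fun _ => M') g → HasBound P (fun _ => K' * M * M') (T f g) := by
  obtain ⟨K', hK', h⟩ := exists_hasBound_of_listDeriv n P
  refine ⟨K' * 2 ^ P * K, by positivity, fun T f g M M' hT hf hg hbf hbg => ?_⟩
  have hM := hbf.nonneg 0
  have hM' := hbg.nonneg 0
  refine (h _ (2 ^ P * (K * M * M')) (hT.contDiff _ _ hf hg) fun L hL z => ?_).mono le_rfl
    fun _ => le_of_eq (by ring)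
  refine (hT.norm_listDeriv_le L hf hg (M := K * M * M') (fun L₁ L₂ hp z => ?_) z).trans ?_
  · have e1 : L.length = L₁.length + L₂.length := by
      rw [← hp.length_eq, List.length_append]
    exact hT.bound _ _ _ _ (hf.listDeriv L₁) (hg.listDeriv L₂)
      (HasBound.listDeriv hf.1 L₁ (hbf.mono (by omega) fun _ => le_rfl))
      (HasBound.listDeriv hg.1 L₂ (hbg.mono (by omega) fun _ => le_rfl)) z
  · gcongr
    norm_num

/-- The constant bounding the Moyal product. -/
noncomputable def starConst (n : ℕ) : ℝ := (exists_norm_star_le n).choose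

lemma starConst_nonneg (n : ℕ) : 0 ≤ starConst n := (exists_norm_star_le n).choose_spec.1

lemma leibnizProduct_star {h : ℝ} (h0 : 0 ≤ h) (h1 : h ≤ 1) :
    LeibnizProduct (n := n) (starConst n) (starOrder n) (star h) where
  contDiff _ _ hf hg := contDiff_star h0 h1 hf hg
  leibniz _ _ v hf hg z := fderiv_star h0 h1 hf hg z v
  bound f g M M' hf hg hbf hbg z :=
    ((exists_norm_star_le n).choose_spec.2 h M M' f g h0 h1 hf hg hbf hbg z).1

/-- The remainder `(f ⋆ g - f g) / h` of the Moyal product. -/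
noncomputable def starRemainder {n : ℕ} (h : ℝ) (f g : PhaseSpace n → ℂ) (z : PhaseSpace n) : ℂ :=
  (h : ℂ)⁻¹ * (star h f g z - f z * g z)

/-- Both ⋆ and pointwise multiplication obey the Leibniz rule, hence so does their difference
divided by `h`. The division is paid for by the factor `h` in the remainder estimate, so the bound
is uniform in `h`. -/
lemma leibnizProduct_starRemainder {h : ℝ} (h0 : 0 < h) (h1 : h ≤ 1) :
    LeibnizProduct (n := n) (starConst n) (starOrder n) (starRemainder h) where
  contDiff f g hf hg := contDiff_const.mul ((contDiff_star h0.le h1 hf hg).sub (hf.1.mul hg.1))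
  leibniz f g v hf hg z := by
    have d1 : DifferentiableAt ℝ (star h f g) z :=
      (contDiff_star h0.le h1 hf hg).differentiable (by simp) z
    have df := hf.differentiable z
    have dg := hg.differentiable z
    have e : HasFDerivAt (starRemainder h f g) ((h : ℂ)⁻¹ • (fderiv ℝ (star h f g) z -
        (f z • fderiv ℝ g z + g z • fderiv ℝ f z))) z :=
      (d1.hasFDerivAt.sub (df.hasFDerivAt.mul dg.hasFDerivAt)).const_mul _
    simp only [show dirDeriv v f = (fun y => fderiv ℝ f y v) from rfl,
      show dirDeriv v g = (fun y => fderiv ℝ g y v) from rfl]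
    simp only [dirDeriv, e.fderiv, starRemainder]
    simp only [smul_apply, sub_apply, add_apply, smul_eq_mul, fderiv_star h0.le h1 hf hg]
    ring
  bound f g M M' hf hg hbf hbg z := by
    have := ((exists_norm_star_le n).choose_spec.2 h M M' f g h0.le h1 hf hg hbf hbg z).2
    rw [starRemainder, norm_mul, norm_inv, Complex.norm_real, Real.norm_of_nonneg h0.le,
      inv_mul_le_iff₀ h0]
    exact this

end Gevrey

/-! ### Weyl quantization on weighted spaces -/

section Weyl

open Filter Topology Module
open scoped FourierTransform RealInnerProductSpace

variable {n : ℕ}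

/-- The exponent of the weights that are integrable on configuration space. -/
noncomputable def configOrder (n : ℕ) : ℕ := finrank ℝ (Config n) + 1

/-- The inner integral of the Weyl quantization. -/
noncomputable def weylInner (h : ℝ) (b : PhaseSpace n → ℂ) (u : Config n → ℂ)
    (x θ : Config n) : ℂ :=
  ∫ y : Config n, Complex.exp (Complex.I * ((inner ℝ (x - y) θ / h : ℝ) : ℂ)) *
        b ((2⁻¹ : ℝ) • (x + y), θ) * u y

lemma weyl_eq (h : ℝ) (b : PhaseSpace n → ℂ) (u : Config n → ℂ) (x : Config n) :
    weyl h b u x = (((2 * Real.pi * h) ^ n)⁻¹ : ℝ) * ∫ θ, weylInner h b u x θ := rfl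

lemma norm_weylIntegrand (h : ℝ) (b : PhaseSpace n → ℂ) (u : Config n → ℂ) (x θ y : Config n) :
    ‖Complex.exp (Complex.I * ((inner ℝ (x - y) θ / h : ℝ) : ℂ)) *
        b ((2⁻¹ : ℝ) • (x + y), θ) * u y‖ = ‖b ((2⁻¹ : ℝ) • (x + y), θ)‖ * ‖u y‖ := by
  rw [norm_mul, norm_mul, Complex.norm_exp_I_mul_ofReal, one_mul]

lemma continuous_weylIntegrand (h : ℝ) {b : PhaseSpace n → ℂ} {u : Config n → ℂ}
    (hb : Continuous b) (hu : Continuous u) :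
    Continuous fun p : (Config n × Config n) × Config n =>
      Complex.exp (Complex.I * ((inner ℝ (p.1.1 - p.2) p.1.2 / h : ℝ) : ℂ)) *
        b ((2⁻¹ : ℝ) • (p.1.1 + p.2), p.1.2) * u p.2 := by
  simp only [div_eq_mul_inv]
  fun_prop

lemma integrable_weylIntegrand (h : ℝ) {b : PhaseSpace n → ℂ} {u : Config n → ℂ}
    (hb : Nice 0 b) (hu : Nice (configOrder n) u) (x θ : Config n) :
    Integrable fun y : Config n =>
      Complex.exp (Complex.I * ((inner ℝ (x - y) θ / h : ℝ) : ℂ)) *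
        b ((2⁻¹ : ℝ) • (x + y), θ) * u y := by
  obtain ⟨M, hM, hbM⟩ := hb.bound 0
  refine (hu.integrable.norm.const_mul M).mono' ?_ (Eventually.of_forall fun y => ?_)
  · exact ((continuous_weylIntegrand h hb.continuous hu.continuous).comp
      (by fun_prop : Continuous fun y : Config n => ((x, θ), y))).aestronglyMeasurable
  · rw [norm_weylIntegrand]
    exact mul_le_mul_of_nonneg_right (hbM.norm_le _) (norm_nonneg _)

lemma continuous_weylInner (h : ℝ) {b : PhaseSpace n → ℂ} {u : Config n → ℂ}
    (hb : Nice 0 b) (hu : Nice (configOrder n) u) :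
    Continuous fun p : Config n × Config n => weylInner h b u p.1 p.2 := by
  obtain ⟨M, hM, hbM⟩ := hb.bound 0
  refine continuous_of_dominated (bound := fun y => M * ‖u y‖)
    (fun p => (integrable_weylIntegrand h hb hu p.1 p.2).aestronglyMeasurable)
    (fun p => Eventually.of_forall fun y => ?_) (hu.integrable.norm.const_mul M)
    (Eventually.of_forall fun y => ?_)
  · rw [norm_weylIntegrand]
    exact mul_le_mul_of_nonneg_right (hbM.norm_le _) (norm_nonneg _)
  · have hc := hb.continuous
    simp only [div_eq_mul_inv]
    fun_prop

/-- The affine map `y ↦ ((x + y) / 2, θ)`, up to its constant part. -/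
noncomputable def halfMap (n : ℕ) : Config n →L[ℝ] PhaseSpace n :=
  ((2⁻¹ : ℝ) • ContinuousLinearMap.id ℝ (Config n)).prod 0

lemma midpoint_eq (b : PhaseSpace n → ℂ) (x θ y : Config n) :
    b ((2⁻¹ : ℝ) • (x + y), θ) = b (halfMap n y + ((2⁻¹ : ℝ) • x, θ)) := by
  congr 1
  simp [halfMap, add_comm]

/-- This replaces integration by parts in y: decay in θ becomes the decay of a Fourier transform. -/
lemma weylInner_eq_fourier (h : ℝ) (b : PhaseSpace n → ℂ) (u : Config n → ℂ) (x θ : Config n) :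
    weylInner h b u x θ = Complex.exp (Complex.I * ((inner ℝ x θ / h : ℝ) : ℂ)) *
      𝓕 (fun y => b (halfMap n y + ((2⁻¹ : ℝ) • x, θ)) * u y) ((2 * Real.pi * h)⁻¹ • θ) := by
  rw [weylInner, Real.fourier_eq', ← integral_const_mul]
  refine integral_congr_ae (Eventually.of_forall fun y => ?_)
  simp only [smul_eq_mul]
  rw [← mul_assoc, ← mul_assoc, ← midpoint_eq b x θ y, ← Complex.exp_add]
  congr 3
  rw [inner_sub_left, inner_smul_right]
  push_cast
  have : (Real.pi : ℂ) ≠ 0 := by exact_mod_cast Real.pi_ne_zero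
  by_cases hh : h = 0
  · subst hh; simp
  · have : (h : ℂ) ≠ 0 := by exact_mod_cast hh
    field_simp
    ring

lemma decay_smul_le {E : Type*} [NormedAddCommGroup E] [NormedSpace ℝ E] (r : ℕ) {c : ℝ}
    (hc : 0 < c) (y : E) : decay r (c • y) ≤ (1 + c⁻¹) ^ r * decay r y := by
  unfold decay
  rw [← div_eq_mul_inv, le_div_iff₀ (by positivity), inv_mul_le_iff₀ (by positivity), ← mul_pow]
  gcongr
  rw [norm_smul, Real.norm_of_nonneg hc.le]
  have : (1 + c * ‖y‖) * (1 + c⁻¹) = 1 + ‖y‖ + (c⁻¹ + c * ‖y‖) := by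
    field_simp; ring
  rw [this]
  have : 0 ≤ c⁻¹ + c * ‖y‖ := by positivity
  linarith

/-- Translating the symbol does not affect its bounds, so the estimate is uniform in `x`. The
constant depends on `h`, which is harmless because operators are only compared at fixed `h`. -/
lemma exists_norm_weylInner_le (n : ℕ) {h : ℝ} (hh : 0 < h) : ∃ C : ℝ, 0 ≤ C ∧
    ∀ (b : PhaseSpace n → ℂ) (u : Config n → ℂ) (M M' : ℝ), Nice 0 b → Nice (configOrder n) u →
    HasBound (configOrder n) (fun _ => M) b →
    HasBound (configOrder n) (fun y => M' * decay (configOrder n) y) u →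
    ∀ x θ, ‖weylInner h b u x θ‖ ≤ C * M * M' * decay (configOrder n) θ := by
  obtain ⟨C, hC, hF⟩ := exists_hasBound_fourier (Config n) (configOrder n) 0
  refine ⟨C * (2 ^ (configOrder n) * (max 1 ‖halfMap n‖) ^ (configOrder n)) *
    (1 + 2 * Real.pi * h) ^ (configOrder n), by positivity,
    fun b u M M' hb hu hbb hbu x θ => ?_⟩
  have hM := hbb.nonneg 0
  have hM' : 0 ≤ M' := nonneg_of_mul_nonneg_left (hbu.nonneg 0) (decay_pos _ _)
  rw [weylInner_eq_fourier, norm_mul, Complex.norm_exp_I_mul_ofReal, one_mul]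
  set c : PhaseSpace n := ((2⁻¹ : ℝ) • x, θ)
  have h1 := ((hbb.translate c).comp_clm (hb.translate c).1 (halfMap n)).mul
    ((hb.translate c).comp_clm (halfMap n)).1 hu.1 hbu
  have h2 := (hF _ (2 ^ (configOrder n) * ((max 1 ‖halfMap n‖) ^ (configOrder n) * M) * M')
    (((hb.translate c).comp_clm (halfMap n)).1.mul hu.1)
    (h1.mono le_rfl fun y => le_of_eq (by
      show _ = _ * decay (configOrder n) y
      ring))).norm_le ((2 * Real.pi * h)⁻¹ • θ)
  refine h2.trans ?_
  have h3 := decay_smul_le (configOrder n) (by positivity : 0 < (2 * Real.pi * h)⁻¹) θ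
  rw [inv_inv] at h3
  calc _ ≤ C * (2 ^ (configOrder n) * ((max 1 ‖halfMap n‖) ^ (configOrder n) * M) * M') *
        ((1 + 2 * Real.pi * h) ^ (configOrder n) * decay (configOrder n) θ) := by gcongr
    _ = _ := by ring

lemma integrable_weylInner {h : ℝ} (hh : 0 < h) {b : PhaseSpace n → ℂ} {u : Config n → ℂ}
    (hb : Nice 0 b) (hu : Nice (configOrder n) u) (x : Config n) :
    Integrable (weylInner h b u x) := by
  obtain ⟨C, hC, hI⟩ := exists_norm_weylInner_le n hh
  obtain ⟨M, hM, hbb⟩ := hb.bound (configOrder n)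
  obtain ⟨M', hM', hbu⟩ := hu.2 (configOrder n)
  exact integrable_of_norm_le_decay ((continuous_weylInner h hb hu).comp
    (by fun_prop : Continuous fun θ : Config n => (x, θ))).aestronglyMeasurable
    (hI b u M M' hb hu hbb hbu x)

lemma exists_norm_weyl_le (n : ℕ) {h : ℝ} (hh : 0 < h) : ∃ C : ℝ, 0 ≤ C ∧
    ∀ (b : PhaseSpace n → ℂ) (u : Config n → ℂ) (M M' : ℝ), Nice 0 b → Nice (configOrder n) u →
    HasBound (configOrder n) (fun _ => M) b →
    HasBound (configOrder n) (fun y => M' * decay (configOrder n) y) u →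
    ∀ x, ‖weyl h b u x‖ ≤ C * M * M' := by
  obtain ⟨C, hC, hI⟩ := exists_norm_weylInner_le n hh
  refine ⟨((2 * Real.pi * h) ^ n)⁻¹ * (C * ∫ θ : Config n, decay (configOrder n) θ), ?_,
    fun b u M M' hb hu hbb hbu x => ?_⟩
  · exact mul_nonneg (by positivity) (mul_nonneg hC (integral_nonneg fun _ => (decay_pos _ _).le))
  · rw [weyl_eq, norm_mul, Complex.norm_real, Real.norm_of_nonneg (by positivity)]
    have : ‖∫ θ, weylInner h b u x θ‖ ≤ ∫ θ, C * M * M' * decay (configOrder n) θ :=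
      norm_integral_le_of_norm_le ((integrable_decay volume).const_mul _)
        (Eventually.of_forall (hI b u M M' hb hu hbb hbu x))
    rw [integral_const_mul] at this
    calc _ ≤ ((2 * Real.pi * h) ^ n)⁻¹ *
          (C * M * M' * ∫ θ : Config n, decay (configOrder n) θ) := by gcongr
      _ = _ := by ring

lemma weylInner_add_left (h : ℝ) {b b' : PhaseSpace n → ℂ} {u : Config n → ℂ}
    (hb : Nice 0 b) (hb' : Nice 0 b') (hu : Nice (configOrder n) u) (x θ : Config n) :
    weylInner h (fun z => b z + b' z) u x θ = weylInner h b u x θ + weylInner h b' u x θ := by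
  unfold weylInner
  rw [← integral_add (integrable_weylIntegrand h hb hu x θ)
    (integrable_weylIntegrand h hb' hu x θ)]
  simp only [mul_add, add_mul]

lemma weylInner_add_right (h : ℝ) {b : PhaseSpace n → ℂ} {u u' : Config n → ℂ}
    (hb : Nice 0 b) (hu : Nice (configOrder n) u) (hu' : Nice (configOrder n) u')
    (x θ : Config n) :
    weylInner h b (fun y => u y + u' y) x θ = weylInner h b u x θ + weylInner h b u' x θ := by
  unfold weylInner
  rw [← integral_add (integrable_weylIntegrand h hb hu x θ)
    (integrable_weylIntegrand h hb hu' x θ)]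
  simp only [mul_add]

lemma weyl_add_left {h : ℝ} (hh : 0 < h) {b b' : PhaseSpace n → ℂ} {u : Config n → ℂ}
    (hb : Nice 0 b) (hb' : Nice 0 b') (hu : Nice (configOrder n) u) (x : Config n) :
    weyl h (fun z => b z + b' z) u x = weyl h b u x + weyl h b' u x := by
  simp only [weyl_eq, weylInner_add_left h hb hb' hu]
  rw [integral_add (integrable_weylInner hh hb hu x) (integrable_weylInner hh hb' hu x), mul_add]

lemma weyl_add_right {h : ℝ} (hh : 0 < h) {b : PhaseSpace n → ℂ} {u u' : Config n → ℂ}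
    (hb : Nice 0 b) (hu : Nice (configOrder n) u) (hu' : Nice (configOrder n) u')
    (x : Config n) :
    weyl h b (fun y => u y + u' y) x = weyl h b u x + weyl h b u' x := by
  simp only [weyl_eq, weylInner_add_right h hb hu hu']
  rw [integral_add (integrable_weylInner hh hb hu x) (integrable_weylInner hh hb hu' x), mul_add]

lemma weylInner_smul_left (h : ℝ) (t : ℂ) (b : PhaseSpace n → ℂ) (u : Config n → ℂ)
    (x θ : Config n) : weylInner h (fun z => t * b z) u x θ = t * weylInner h b u x θ := by
  unfold weylInner
  rw [← integral_const_mul]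
  exact integral_congr_ae (Eventually.of_forall fun y => by ring)

lemma weylInner_smul_right (h : ℝ) (t : ℂ) (b : PhaseSpace n → ℂ) (u : Config n → ℂ)
    (x θ : Config n) : weylInner h b (fun y => t * u y) x θ = t * weylInner h b u x θ := by
  unfold weylInner
  rw [← integral_const_mul]
  exact integral_congr_ae (Eventually.of_forall fun y => by ring)

lemma weyl_smul_left (h : ℝ) (t : ℂ) (b : PhaseSpace n → ℂ) (u : Config n → ℂ)
    (x : Config n) : weyl h (fun z => t * b z) u x = t * weyl h b u x := by
  simp only [weyl_eq, weylInner_smul_left]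
  rw [integral_const_mul]
  ring

lemma weyl_smul_right (h : ℝ) (t : ℂ) (b : PhaseSpace n → ℂ) (u : Config n → ℂ)
    (x : Config n) : weyl h b (fun y => t * u y) x = t * weyl h b u x := by
  simp only [weyl_eq, weylInner_smul_right]
  rw [integral_const_mul]
  ring

lemma boundedForm_weyl {h : ℝ} (hh : 0 < h) : BoundedForm 0 (configOrder n)
    (fun (b : PhaseSpace n → ℂ) (u : Config n → ℂ) => weyl h b u 0) where
  add_left _ _ _ hb hb' hu := weyl_add_left hh hb hb' hu 0
  smul_left t b u _ _ := weyl_smul_left h t b u 0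
  add_right _ _ _ hb hu hu' := weyl_add_right hh hb hu hu' 0
  smul_right t b u _ _ := weyl_smul_right h t b u 0
  bound := by
    obtain ⟨C, hC, hb⟩ := exists_norm_weyl_le n hh
    exact ⟨C, configOrder n, hC, fun b u M M' hb' hu _ _ hbb hbu =>
      hb b u M M' hb' hu (by simpa using hbb) hbu 0⟩

/-- Substituting y + x for y moves the point x into translations of the symbol and of `u`; the
smoothness and Leibniz rule for bounded forms then apply to Weyl operators too. -/
lemma weyl_eq_translated (h : ℝ) (b : PhaseSpace n → ℂ) (u : Config n → ℂ) :
    weyl h b u = BoundedForm.translated (fun (b : PhaseSpace n → ℂ) u => weyl h b u 0)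
      (ContinuousLinearMap.inl ℝ (Config n) (Config n)) (ContinuousLinearMap.id ℝ _) b u := by
  funext x
  simp only [BoundedForm.translated, weyl_eq, ContinuousLinearMap.inl_apply,
    ContinuousLinearMap.id_apply]
  congr 2
  funext θ
  unfold weylInner
  rw [← integral_add_right_eq_self _ x]
  refine integral_congr_ae (Eventually.of_forall fun y => ?_)
  simp only [Prod.mk_add_mk, add_zero, zero_add]
  congr 3
  · congr 3
    abel_nf
  · congr 2
    rw [smul_add, smul_add]
    have : x = (2⁻¹ : ℝ) • x + (2⁻¹ : ℝ) • x := by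
      rw [← add_smul]; norm_num
    conv_rhs => rw [this]
    abel

lemma contDiff_weyl {h : ℝ} (hh : 0 < h) {b : PhaseSpace n → ℂ} {u : Config n → ℂ}
    (hb : Nice 0 b) (hu : Nice (configOrder n) u) : ContDiff ℝ ∞ (weyl h b u) := by
  rw [weyl_eq_translated]
  exact (boundedForm_weyl hh).contDiff_translated _ _ hb hu

lemma fderiv_weyl {h : ℝ} (hh : 0 < h) {b : PhaseSpace n → ℂ} {u : Config n → ℂ}
    (hb : Nice 0 b) (hu : Nice (configOrder n) u) (x v : Config n) :
    fderiv ℝ (weyl h b u) x v = weyl h (fun z => fderiv ℝ b z (v, 0)) u x +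
      weyl h b (fun y => fderiv ℝ u y v) x := by
  rw [weyl_eq_translated, (boundedForm_weyl hh).fderiv_translated _ _ hb hu,
    ← weyl_eq_translated, ← weyl_eq_translated]
  rfl

/-- Dominated convergence is used twice, for the y-integral and for the θ-integral; the latter
relies on the uniform derivative bounds. -/
lemma tendsto_weyl {h : ℝ} (hh : 0 < h) {A : ℕ → PhaseSpace n → ℂ} {a : PhaseSpace n → ℂ}
    {u : Config n → ℂ} {M : ℝ} (hA : ∀ j, Nice 0 (A j)) (hu : Nice (configOrder n) u)
    (hb : ∀ j, HasBound (configOrder n) (fun _ => M) (A j))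
    (hlim : ∀ z, Tendsto (fun j => A j z) atTop (𝓝 (a z))) (x : Config n) :
    Tendsto (fun j => weyl h (A j) u x) atTop (𝓝 (weyl h a u x)) := by
  obtain ⟨C, hC, hI⟩ := exists_norm_weylInner_le n hh
  obtain ⟨M', hM', hbu⟩ := hu.2 (configOrder n)
  simp only [weyl_eq]
  refine Tendsto.const_mul _ ?_
  refine tendsto_integral_of_dominated_convergence
    (fun θ => C * M * M' * decay (configOrder n) θ)
    (fun j => (integrable_weylInner hh (hA j) hu x).aestronglyMeasurable)
    ((integrable_decay volume).const_mul _) (fun j => Eventually.of_forall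
      (hI (A j) u M M' (hA j) hu (hb j) hbu x)) (Eventually.of_forall fun θ => ?_)
  refine tendsto_integral_of_dominated_convergence (fun y => M * ‖u y‖)
    (fun j => (integrable_weylIntegrand h (hA j) hu x θ).aestronglyMeasurable)
    (hu.integrable.norm.const_mul M) (fun j => Eventually.of_forall fun y => ?_)
    (Eventually.of_forall fun y => ?_)
  · rw [norm_weylIntegrand]
    exact mul_le_mul_of_nonneg_right ((hb j).norm_le _) (norm_nonneg _)
  · exact ((hlim _).const_mul _).mul_const _

end Weyl

/-! ### Multiplication by linear functions -/

section LinearMultiplication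

variable {E : Type*} [NormedAddCommGroup E] [NormedSpace ℝ E]

lemma hasBound_clm (ℓ : E →L[ℝ] ℂ) (N : ℕ) : HasBound N (fun y => ‖ℓ‖ * (1 + ‖y‖)) ℓ := by
  intro p hp y
  have h0 : ‖ℓ‖ ≤ ‖ℓ‖ * (1 + ‖y‖) :=
    le_mul_of_one_le_right (norm_nonneg _) (by linarith [norm_nonneg y])
  rcases p with _ | p
  · rw [norm_iteratedFDeriv_zero]
    refine (ℓ.le_opNorm y).trans (mul_le_mul_of_nonneg_left ?_ (norm_nonneg _))
    linarith
  · rw [← norm_iteratedFDeriv_fderiv]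
    have : fderiv ℝ ℓ = fun _ => ℓ := funext fun z => ℓ.fderiv
    rw [this]
    rcases p with _ | p
    · rw [norm_iteratedFDeriv_zero]
      exact h0
    · rw [iteratedFDeriv_const_of_ne (by omega)]
      simpa using (norm_nonneg ℓ).trans h0

lemma Nice.clm_mul {r : ℕ} {u : E → ℂ} (hu : Nice (r + 1) u) (ℓ : E →L[ℝ] ℂ) :
    Nice r (fun y => ℓ y * u y) := by
  refine ⟨ℓ.contDiff.mul hu.1, fun N => ?_⟩
  obtain ⟨M, hM, hb⟩ := hu.2 N
  refine ⟨2 ^ N * ‖ℓ‖ * M, by positivity,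
    ((hasBound_clm ℓ N).mul ℓ.contDiff hu.1 hb).mono le_rfl fun y => le_of_eq ?_⟩
  simp only [decay, pow_succ]
  field_simp

lemma Rapid.clm_mul {u : E → ℂ} (hu : Rapid u) (ℓ : E →L[ℝ] ℂ) :
    Rapid (fun y => ℓ y * u y) :=
  fun r => (hu (r + 1)).clm_mul ℓ

lemma Rapid.fderiv_apply {u : E → ℂ} (hu : Rapid u) (v : E) :
    Rapid (fun y => fderiv ℝ u y v) :=
  fun r => (hu r).fderiv_apply v

/-- Bounds of the derivatives of order `p + 1` follow from bounds of the derivatives of order `p`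
of all directional derivatives. -/
lemma exists_norm_iteratedFDeriv_succ_le [FiniteDimensional ℝ E] {f : E → ℂ}
    (hf : ContDiff ℝ ∞ f) {p r : ℕ}
    (h : ∀ v, ∃ C : ℝ, ∀ x, ‖iteratedFDeriv ℝ p (fun y => fderiv ℝ f y v) x‖ ≤ C * decay r x) :
    ∃ C : ℝ, ∀ x, ‖iteratedFDeriv ℝ (p + 1) f x‖ ≤ C * decay r x := by
  set e := Module.finBasis ℝ E
  set T : Fin (Module.finrank ℝ E) → ℂ →L[ℝ] E →L[ℝ] ℂ := fun i =>
    ContinuousLinearMap.smulRightL ℝ E ℂ (LinearMap.toContinuousLinearMap (e.coord i))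
  have hfd : fderiv ℝ f = fun z => ∑ i, T i (fderiv ℝ f z (e i)) := by
    funext z
    refine ContinuousLinearMap.ext fun v => ?_
    conv_lhs => rw [← e.sum_repr v, map_sum]
    simp [T]
  have hs (v : E) : ContDiff ℝ ∞ (fun y => fderiv ℝ f y v) :=
    (hf.fderiv_right (m := ∞) (by simp)).clm_apply contDiff_const
  choose C hC using fun i => h (e i)
  refine ⟨∑ i, ‖T i‖ * C i, fun x => ?_⟩
  rw [← norm_iteratedFDeriv_fderiv, hfd,
    iteratedFDeriv_fun_sum_apply (f := fun i z => T i (fderiv ℝ f z (e i)))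
      (fun i _ => (((T i).contDiff.comp (hs (e i))).of_le (by exact_mod_cast le_top)).contDiffAt),
    Finset.sum_mul]
  refine (norm_sum_le _ _).trans (Finset.sum_le_sum fun i _ => ?_)
  refine ((T i).norm_iteratedFDeriv_comp_left ((hs (e i)).contDiffAt (n := ∞))
    (by exact_mod_cast le_top)).trans ?_
  rw [mul_assoc]
  exact mul_le_mul_of_nonneg_left (hC i x) (norm_nonneg _)

end LinearMultiplication

/-! ### Weyl operators preserve rapid decay -/

section WeylDecay

open Filter Topology Module
open scoped FourierTransform RealInnerProductSpace

variable {n : ℕ}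

/-- The functional `y ↦ ⟪w, y⟫`, with complex values. -/
noncomputable def innerFun (w : Config n) : Config n →L[ℝ] ℂ :=
  Complex.ofRealCLM.comp (innerSL ℝ w)

@[simp] lemma innerFun_apply (w y : Config n) : innerFun w y = ((inner ℝ w y : ℝ) : ℂ) := rfl

lemma hasDerivAt_weylInner (h : ℝ) {b : PhaseSpace n → ℂ} {u : Config n → ℂ}
    (hb : Nice 0 b) (hu : Rapid u) (x θ w : Config n) :
    HasDerivAt (fun t : ℝ => weylInner h b u x (θ + t • w))
      (Complex.I / h * (innerFun w x * weylInner h b u x θ -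
        weylInner h b (fun y => innerFun w y * u y) x θ) +
        weylInner h (fun z => fderiv ℝ b z (0, w)) u x θ) 0 := by
  set F : ℝ → Config n → ℂ := fun t y =>
    Complex.exp (Complex.I * ((inner ℝ (x - y) (θ + t • w) / h : ℝ) : ℂ)) *
        b ((2⁻¹ : ℝ) • (x + y), θ + t • w) * u y with hF
  set F' : ℝ → Config n → ℂ := fun t y =>
    Complex.I / h * innerFun w x * F t y - Complex.I / h *
      (Complex.exp (Complex.I * ((inner ℝ (x - y) (θ + t • w) / h : ℝ) : ℂ)) *
        b ((2⁻¹ : ℝ) • (x + y), θ + t • w) * (innerFun w y * u y)) +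
      Complex.exp (Complex.I * ((inner ℝ (x - y) (θ + t • w) / h : ℝ) : ℂ)) *
        fderiv ℝ b ((2⁻¹ : ℝ) • (x + y), θ + t • w) (0, w) * u y with hF'
  have hb' : Nice 0 (fun z => fderiv ℝ b z (0, w)) := hb.fderiv_apply _
  have hu' : Rapid (fun y => innerFun w y * u y) := hu.clm_mul _
  have i1 (t : ℝ) := integrable_weylIntegrand h hb (hu (configOrder n)) x (θ + t • w)
  have i2 (t : ℝ) := integrable_weylIntegrand h hb (hu' (configOrder n)) x (θ + t • w)
  have i3 (t : ℝ) := integrable_weylIntegrand h hb' (hu (configOrder n)) x (θ + t • w)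
  obtain ⟨M, hM, hbM⟩ := hb.bound 0
  obtain ⟨M', hM', hbM'⟩ := hb'.bound 0
  have key := hasDerivAt_integral_of_dominated_loc_of_deriv_le (μ := volume) (s := Set.univ)
    (x₀ := (0 : ℝ)) (F := F) (F' := F')
    (bound := fun y => ‖Complex.I / h * innerFun w x‖ * (M * ‖u y‖) +
      ‖Complex.I / h‖ * (M * ‖innerFun w y * u y‖) + M' * ‖u y‖) univ_mem
    (Eventually.of_forall fun t => (i1 t).aestronglyMeasurable) (i1 0)
    ((((i1 0).const_mul _).sub ((i2 0).const_mul _)).add (i3 0)).aestronglyMeasurable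
    (Eventually.of_forall fun y t _ => ?_) ?_ (Eventually.of_forall fun y t _ => ?_)
  · refine key.2.congr_deriv ?_
    have e1 := integral_add (((i1 0).const_mul (Complex.I / h * innerFun w x)).sub
      ((i2 0).const_mul (Complex.I / h))) (i3 0)
    have e2 := integral_sub ((i1 0).const_mul (Complex.I / h * innerFun w x))
      ((i2 0).const_mul (Complex.I / h))
    refine e1.trans ?_
    refine (congrArg (· + _) e2).trans ?_
    rw [integral_const_mul, integral_const_mul]
    simp only [zero_smul, add_zero, weylInner]
    ring
  · refine (norm_add_le _ _).trans (add_le_add ((norm_sub_le _ _).trans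
      (add_le_add ?_ ?_)) ?_)
    · rw [norm_mul, hF, norm_weylIntegrand]
      gcongr
      exact hbM.norm_le _
    · rw [norm_mul, norm_weylIntegrand h b (fun y => innerFun w y * u y)]
      gcongr
      exact hbM.norm_le _
    · rw [norm_weylIntegrand h (fun z => fderiv ℝ b z (0, w))]
      gcongr
      exact hbM'.norm_le _
  · exact (((hu.integrable.norm.const_mul M).const_mul _).add
      ((hu'.integrable.norm.const_mul M).const_mul _)).add (hu.integrable.norm.const_mul M')
  · have d1 : HasDerivAt (fun t : ℝ => θ + t • w) w t := by
      simpa using ((hasDerivAt_id t).smul_const w).const_add θ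
    have d2 : HasDerivAt (fun t : ℝ => (inner ℝ (x - y) (θ + t • w) / h : ℝ))
        (inner ℝ (x - y) w / h) t :=
      (((innerSL ℝ (x - y)).hasFDerivAt (x := θ + t • w)).comp_hasDerivAt t d1).div_const h
    have d3 := (d2.ofReal_comp.const_mul Complex.I).cexp
    have d4 : HasDerivAt (fun t : ℝ => b ((2⁻¹ : ℝ) • (x + y), θ + t • w))
        (fderiv ℝ b ((2⁻¹ : ℝ) • (x + y), θ + t • w) (0, w)) t :=
      ((hb.differentiable _).hasFDerivAt).comp_hasDerivAt t
        ((hasDerivAt_const t ((2⁻¹ : ℝ) • (x + y))).prodMk d1)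
    refine ((d3.mul d4).mul_const (u y)).congr_deriv ?_
    simp only [hF', hF, innerFun_apply, inner_sub_left]
    push_cast
    rw [real_inner_comm w x, real_inner_comm w y]
    ring

/-- The commutator of x with a Weyl operator: the θ-integral of the θ-derivative of the inner
integral vanishes, and differentiating the phase produces the factor i(x - y)/h. -/
lemma inner_mul_weyl {h : ℝ} (hh : 0 < h) {b : PhaseSpace n → ℂ} {u : Config n → ℂ}
    (hb : Nice 0 b) (hu : Rapid u) (x w : Config n) :
    innerFun w x * weyl h b u x = weyl h b (fun y => innerFun w y * u y) x +
      Complex.I * h * weyl h (fun z => fderiv ℝ b z (0, w)) u x := by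
  have hb' : Nice 0 (fun z => fderiv ℝ b z (0, w)) := hb.fderiv_apply _
  have hu' : Rapid (fun y => innerFun w y * u y) := hu.clm_mul _
  have i1 := integrable_weylInner hh hb (hu (configOrder n)) x
  have i2 := integrable_weylInner hh hb (hu' (configOrder n)) x
  have i3 := integrable_weylInner hh hb' (hu (configOrder n)) x
  have e12 : Integrable fun θ => Complex.I / h * (innerFun w x * weylInner h b u x θ -
        weylInner h b (fun y => innerFun w y * u y) x θ) :=
    ((i1.const_mul (innerFun w x)).sub i2).const_mul _
  -- Integration by parts against the constant function 1, whose derivative is zero.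
  have key := integral_bilinear_hasLineDerivAt_right_eq_neg_left_of_integrable (v := w)
    (μ := (volume : Measure (Config n)))
    (B := ContinuousLinearMap.mul ℝ ℂ) (f := fun _ : Config n => (1 : ℂ)) (f' := fun _ => 0)
    (g := weylInner h b u x) (g' := fun θ => Complex.I / h * (innerFun w x *
      weylInner h b u x θ - weylInner h b (fun y => innerFun w y * u y) x θ) +
        weylInner h (fun z => fderiv ℝ b z (0, w)) u x θ) (by simp)
    (by simp only [ContinuousLinearMap.mul_apply', one_mul]; exact e12.add i3) (by simpa using i1)
    (fun θ _ => hasDerivAt_const _ _)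
    (fun θ _ => hasDerivAt_weylInner h hb hu x θ w)
  simp only [ContinuousLinearMap.mul_apply', one_mul, zero_mul, integral_zero, neg_zero] at key
  rw [integral_add e12 i3, integral_const_mul, integral_sub (i1.const_mul _) i2,
    integral_const_mul] at key
  have hc : (h : ℂ) ≠ 0 := by exact_mod_cast hh.ne'
  simp only [weyl_eq]
  set A := ∫ θ, weylInner h b u x θ
  set B := ∫ θ, weylInner h b (fun y => innerFun w y * u y) x θ
  set D := ∫ θ, weylInner h (fun z => fderiv ℝ b z (0, w)) u x θ
  have key2 : innerFun w x * A = B + Complex.I * h * D := by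
    have hI : Complex.I / h * (innerFun w x * A - B) = -D := by linear_combination key
    have : (innerFun w x * A - B) = -D * (h / Complex.I) := by
      rw [← hI]; field_simp [Complex.I_ne_zero]
    rw [Complex.div_I] at this
    linear_combination this
  linear_combination ((((2 * Real.pi * h) ^ n)⁻¹ : ℝ) : ℂ) * key2

/-- Each power of decay is gained by multiplying with a coordinate of x and commuting it onto `u` or
onto a θ-derivative of the symbol; hence the induction runs over all `b` and `u`. -/
lemma exists_norm_weyl_le_decay {h : ℝ} (hh : 0 < h) (r : ℕ) {b : PhaseSpace n → ℂ}
    {u : Config n → ℂ} (hb : Nice 0 b) (hu : Rapid u) :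
    ∃ C : ℝ, 0 ≤ C ∧ ∀ x, ‖weyl h b u x‖ ≤ C * decay r x := by
  induction r generalizing b u with
  | zero =>
    obtain ⟨C, hC, hb'⟩ := exists_norm_weyl_le n hh
    obtain ⟨M, hM, hbb⟩ := hb.bound (configOrder n)
    obtain ⟨M', hM', hbu⟩ := (hu (configOrder n)).2 (configOrder n)
    exact ⟨C * M * M', by positivity, by simpa using hb' b u M M' hb (hu _) hbb hbu⟩
  | succ r ih =>
    set e : Fin n → Config n := fun i => EuclideanSpace.single i 1
    obtain ⟨C₀, hC₀, h0⟩ := ih hb hu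
    choose C hC h1 using fun i => ih hb (hu.clm_mul (innerFun (e i)))
    choose C' hC' h2 using fun i => ih (hb.fderiv_apply (0, e i)) hu
    refine ⟨C₀ + ∑ i, (C i + h * C' i), add_nonneg hC₀ (Finset.sum_nonneg fun i _ =>
      add_nonneg (hC i) (mul_nonneg hh.le (hC' i))), fun x => ?_⟩
    have hx : ‖x‖ ≤ ∑ i, ‖innerFun (e i) x‖ := by
      calc ‖x‖ = ‖∑ i, x i • e i‖ := by
            congr 1
            ext k
            simp [e, Pi.single_apply]
        _ ≤ ∑ i, ‖x i • e i‖ := norm_sum_le _ _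
        _ = _ := by
          refine Finset.sum_congr rfl fun i _ => ?_
          rw [norm_smul]
          simp [e, EuclideanSpace.inner_single_left]
    have key : (1 + ‖x‖) * ‖weyl h b u x‖ ≤ (C₀ + ∑ i, (C i + h * C' i)) * decay r x := by
      calc (1 + ‖x‖) * ‖weyl h b u x‖
          ≤ (1 + ∑ i, ‖innerFun (e i) x‖) * ‖weyl h b u x‖ := by gcongr
        _ = ‖weyl h b u x‖ + ∑ i, ‖innerFun (e i) x * weyl h b u x‖ := by
          rw [add_mul, one_mul, Finset.sum_mul]
          simp only [norm_mul]
        _ ≤ C₀ * decay r x + ∑ i, (C i + h * C' i) * decay r x := by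
          refine add_le_add (h0 x) (Finset.sum_le_sum fun i _ => ?_)
          rw [inner_mul_weyl hh hb hu]
          refine (norm_add_le _ _).trans ?_
          rw [norm_mul, norm_mul, Complex.norm_I, one_mul, Complex.norm_real,
            Real.norm_of_nonneg hh.le, add_mul, mul_assoc]
          exact add_le_add (h1 i x) (mul_le_mul_of_nonneg_left (h2 i x) hh.le)
        _ = _ := by rw [add_mul, Finset.sum_mul]
    have : decay (r + 1) x = decay r x * (1 + ‖x‖)⁻¹ := by
      simp [decay, pow_succ, mul_comm]
    rw [this, ← mul_assoc, ← div_eq_mul_inv, le_div_iff₀ (by positivity), mul_comm]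
    exact key

/-- Weyl operators whose symbols have bounded derivatives preserve the Schwartz space. -/
lemma Rapid.weyl {h : ℝ} (hh : 0 < h) {b : PhaseSpace n → ℂ} {u : Config n → ℂ}
    (hb : Nice 0 b) (hu : Rapid u) : Rapid (weyl h b u) := by
  intro r
  have key (p : ℕ) : ∀ {b : PhaseSpace n → ℂ} {u : Config n → ℂ}, Nice 0 b → Rapid u →
      ∃ C : ℝ, ∀ x, ‖iteratedFDeriv ℝ p (GevreyWeyl.weyl h b u) x‖ ≤ C * decay r x := by
    induction p with
    | zero =>
      intro b u hb hu
      obtain ⟨C, _, hC⟩ := exists_norm_weyl_le_decay hh r hb hu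
      exact ⟨C, by simpa using hC⟩
    | succ p ih =>
      intro b u hb hu
      refine exists_norm_iteratedFDeriv_succ_le (contDiff_weyl hh hb (hu _)) fun v => ?_
      obtain ⟨C, hC⟩ := ih (hb.fderiv_apply (v, 0)) hu
      obtain ⟨C', hC'⟩ := ih hb (hu.fderiv_apply v)
      refine ⟨C + C', fun x => ?_⟩
      simp only [fderiv_weyl hh hb (hu _)]
      have le : (p : ℕ∞ω) ≤ ∞ := by exact_mod_cast le_top
      rw [fun_iteratedFDeriv_add_apply
        ((contDiff_weyl hh (hb.fderiv_apply _) (hu _)).of_le le).contDiffAt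
        ((contDiff_weyl hh hb (hu.fderiv_apply v _)).of_le le).contDiffAt, add_mul]
      exact (norm_add_le _ _).trans (add_le_add (hC x) (hC' x))
  refine ⟨contDiff_weyl hh hb (hu _), fun N => ?_⟩
  choose C hC using fun p => key p hb hu
  have hC0 (p : ℕ) : 0 ≤ C p :=
    nonneg_of_mul_nonneg_left ((norm_nonneg _).trans (hC p 0)) (decay_pos _ _)
  refine ⟨∑ p ∈ Finset.range (N + 1), C p, Finset.sum_nonneg fun p _ => hC0 p,
    fun p hp x => (hC p x).trans ?_⟩
  exact mul_le_mul_of_nonneg_right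
    (Finset.single_le_sum (f := C) (fun p _ => hC0 p) (Finset.mem_range.2 (by omega)))
    (decay_pos _ _).le

end WeylDecay

/-! ### Injectivity of the quantization -/

section Uniqueness

open Filter Topology Module
open scoped FourierTransform RealInnerProductSpace

variable {n : ℕ}

/-- A rapidly decaying smooth function as a Schwartz function. -/
def Rapid.toSchwartz {E : Type*} [NormedAddCommGroup E] [NormedSpace ℝ E] {u : E → ℂ}
    (hu : Rapid u) : 𝓢(E, ℂ) where
  toFun := u
  smooth' := (hu 0).1
  decay' k p := by
    obtain ⟨M, hM, hb⟩ := (hu k).2 p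
    refine ⟨M, fun x => ?_⟩
    have h1 := hb p le_rfl x
    simp only [decay] at h1
    rw [← div_eq_mul_inv, le_div_iff₀ (by positivity)] at h1
    calc _ ≤ (1 + ‖x‖) ^ k * ‖iteratedFDeriv ℝ p u x‖ := by gcongr; linarith
      _ ≤ M := by rw [mul_comm]; exact h1

lemma Rapid.translate {E : Type*} [NormedAddCommGroup E] [NormedSpace ℝ E] {u : E → ℂ}
    (hu : Rapid u) (v : E) : Rapid (fun y => u (y + v)) :=
  fun r => (hu r).translate v

/-- Shifting `u` and x by opposite motions keeps the midpoint and moves x - y by hq, so only the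
phase changes, by e^{iq·θ}. -/
lemma weylInner_shift {h : ℝ} (hh : h ≠ 0) (b : PhaseSpace n → ℂ) (u : Config n → ℂ)
    (x θ q : Config n) :
    weylInner h b (fun y => u (y + (h / 2) • q)) (x + (h / 2) • q) θ =
      Complex.exp (Complex.I * ((inner ℝ q θ : ℝ) : ℂ)) * weylInner h b u x θ := by
  unfold weylInner
  rw [← integral_const_mul, ← integral_add_right_eq_self (fun y : Config n => _ * (_ * _ * _))
    ((h / 2) • q)]
  refine integral_congr_ae (Eventually.of_forall fun y => ?_)
  simp only
  rw [← mul_assoc, ← mul_assoc, ← Complex.exp_add]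
  congr 3
  · have e : x + (h / 2) • q - y = h • q + (x - (y + (h / 2) • q)) := by
      have : h • q = (h / 2) • q + (h / 2) • q := by rw [← add_smul]; ring_nf
      rw [this]; abel
    have hc : (h : ℂ) ≠ 0 := by exact_mod_cast hh
    rw [e, inner_add_left, inner_smul_left]
    simp only [conj_trivial]
    push_cast
    field_simp
  · congr 2
    abel

/-- Testing on translates of `u` shows that the Fourier transform in θ of the inner integral
vanishes, so the θ-integral can be removed; varying `u` then removes the y-integral. -/
lemma eq_zero_of_weyl_eq_zero {h : ℝ} (hh : 0 < h) {d : PhaseSpace n → ℂ} (hd : Nice 0 d)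
    (h0 : ∀ u : 𝓢(Config n, ℂ), ∀ x, weyl h d u x = 0) (z : PhaseSpace n) : d z = 0 := by
  have step1 (u : Config n → ℂ) (hu : Rapid u) (x θ : Config n) : weylInner h d u x θ = 0 := by
    have hI := integrable_weylInner hh hd (hu (configOrder n)) x
    have hc : Continuous fun θ => weylInner h d u x θ :=
      Continuous.comp (g := fun p : Config n × Config n => weylInner h d u p.1 p.2)
        (f := fun θ => (x, θ)) (continuous_weylInner h hd (hu (configOrder n))) (by fun_prop)
    have hF : 𝓕 (weylInner h d u x) = 0 := by
      funext ξ
      -- The shift q = -2πξ turns e^{iq·θ} into the Fourier kernel at ξ.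
      have h1 := h0 (hu.translate ((h / 2) • ((-2 * Real.pi) • ξ))).toSchwartz
        (x + (h / 2) • ((-2 * Real.pi) • ξ))
      have h2 : weyl h d (fun y => u (y + (h / 2) • ((-2 * Real.pi) • ξ)))
        (x + (h / 2) • ((-2 * Real.pi) • ξ)) = 0 := h1
      rw [weyl_eq] at h2
      simp only [weylInner_shift hh.ne'] at h2
      have hne : ((((2 * Real.pi * h) ^ n)⁻¹ : ℝ) : ℂ) ≠ 0 := by
        have : (0 : ℝ) < ((2 * Real.pi * h) ^ n)⁻¹ := by positivity
        exact_mod_cast this.ne'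
      have h3 := (mul_eq_zero.1 h2).resolve_left hne
      rw [Real.fourier_eq', Pi.zero_apply, ← h3]
      refine integral_congr_ae (Eventually.of_forall fun θ => ?_)
      simp only [smul_eq_mul]
      congr 2
      rw [inner_smul_left, real_inner_comm]
      simp
      ring
    have hc' : Continuous (weylInner h d u x) := hc
    have := hc'.fourierInv_fourier_eq hI (by rw [hF]; exact integrable_zero _ _ _)
    rw [← this, hF, Real.fourierInv_eq]
    simp
  have hc : Continuous fun y : Config n =>
      Complex.exp (Complex.I * ((inner ℝ (z.1 - y) z.2 / h : ℝ) : ℂ)) *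
        d ((2⁻¹ : ℝ) • (z.1 + y), z.2) := by
    have := hd.continuous
    simp only [div_eq_mul_inv]
    fun_prop
  have hae := ae_eq_zero_of_integral_contDiff_smul_eq_zero (μ := volume)
    hc.locallyIntegrable fun g hg hgs => by
      have hr : Rapid (fun y => (g y : ℂ)) :=
        HasCompactSupport.rapid (hgs.comp_left (g := fun t : ℝ => (t : ℂ)) (by simp))
          (Complex.ofRealCLM.contDiff.comp hg)
      rw [← step1 _ hr z.1 z.2, weylInner]
      refine integral_congr_ae (Eventually.of_forall fun y => ?_)
      simp only [Complex.real_smul]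
      ring
  -- Continuity upgrades almost everywhere to everywhere, and at y = x = z.1 the phase is 1 and the
  -- midpoint is z.1.
  have hz := congrFun (hc.ae_eq_iff_eq volume continuous_const |>.1 hae) z.1
  simp only [sub_self, inner_zero_left, zero_div, Complex.ofReal_zero, mul_zero, Complex.exp_zero,
    one_mul] at hz
  rw [← hz]
  congr 1
  ext1
  · simp only
    rw [← two_smul ℝ, smul_smul]
    norm_num
  · rfl

end Uniqueness

/-! ### Composition with compactly supported symbols -/

section Superposition

open Filter Topology Module
open scoped FourierTransform RealInnerProductSpace

variable {n : ℕ}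

/-- The plane wave with frequency `ζ` on phase space. -/
noncomputable def planeWave (ζ : Frequency n) (z : PhaseSpace n) : ℂ :=
  Complex.exp (Complex.I * ((2 * Real.pi * (inner ℝ ζ.fst z.1 + inner ℝ ζ.snd z.2) : ℝ) : ℂ))

lemma norm_planeWave (ζ : Frequency n) (z : PhaseSpace n) : ‖planeWave ζ z‖ = 1 :=
  Complex.norm_exp_I_mul_ofReal _

/-- The phase factor of the Heisenberg translation with frequency `ζ`. -/
noncomputable def shiftPhase (h : ℝ) (ζ : Frequency n) (x : Config n) : ℂ :=
  Complex.exp (Complex.I *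
    ((2 * Real.pi * inner ℝ ζ.fst (x + (Real.pi * h) • ζ.snd) : ℝ) : ℂ))

lemma norm_shiftPhase (h : ℝ) (ζ : Frequency n) (x : Config n) : ‖shiftPhase h ζ x‖ = 1 :=
  Complex.norm_exp_I_mul_ofReal _

lemma continuous_fst_snd : (Continuous fun ζ : Frequency n => ζ.fst) ∧
    Continuous fun ζ : Frequency n => ζ.snd :=
  ⟨(toPhase n).continuous.fst, (toPhase n).continuous.snd⟩

/-- The plane wave and the shift of `b` by hσζ amount to moving x by 2πhq and θ by -πhp, up to a
phase independent of y and θ. -/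
lemma weylIntegrand_planeWave {h : ℝ} (hh : h ≠ 0) (b : PhaseSpace n → ℂ) (u : Config n → ℂ)
    (x θ y : Config n) (ζ : Frequency n) :
    Complex.exp (Complex.I * ((inner ℝ (x - y) θ / h : ℝ) : ℂ)) *
        (planeWave ζ ((2⁻¹ : ℝ) • (x + y), θ) *
          b (((2⁻¹ : ℝ) • (x + y), θ) + (h • symplecticMap n) ζ)) * u y =
      shiftPhase h ζ x * (Complex.exp (Complex.I *
        ((inner ℝ (x + (2 * Real.pi * h) • ζ.snd - y) (θ - (Real.pi * h) • ζ.fst) / h : ℝ) : ℂ)) *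
        b ((2⁻¹ : ℝ) • (x + (2 * Real.pi * h) • ζ.snd + y), θ - (Real.pi * h) • ζ.fst) * u y) := by
  have e1 : (((2⁻¹ : ℝ) • (x + y), θ) : PhaseSpace n) + (h • symplecticMap n) ζ =
      ((2⁻¹ : ℝ) • (x + (2 * Real.pi * h) • ζ.snd + y), θ - (Real.pi * h) • ζ.fst) := by
    simp only [smul_apply, symplecticMap_apply, Prod.smul_mk, Prod.mk_add_mk, smul_smul]
    ext1
    · simp only [smul_add, smul_smul]
      rw [show (2⁻¹ : ℝ) * (2 * Real.pi * h) = h * Real.pi by ring]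
      abel
    · simp only [sub_eq_add_neg, ← neg_smul]
      congr 2
      ring
  rw [e1, planeWave, shiftPhase]
  simp only [← mul_assoc]
  rw [← Complex.exp_add, ← Complex.exp_add]
  congr 3
  have hc : (h : ℂ) ≠ 0 := by exact_mod_cast hh
  simp only [inner_add_left, inner_sub_left, inner_add_right, inner_sub_right, inner_smul_left,
    inner_smul_right, conj_trivial]
  rw [real_inner_comm ζ.fst x, real_inner_comm ζ.fst y, real_inner_comm ζ.fst ζ.snd]
  push_cast
  field_simp
  ring

/-- The superposition of the plane waves, multiplied by translates of `b`, with density `K`. -/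
noncomputable def superposition (h : ℝ) (K : Frequency n → ℂ) (b : PhaseSpace n → ℂ)
    (z : PhaseSpace n) : ℂ :=
  ∫ ζ, K ζ * (planeWave ζ z * b (z + (h • symplecticMap n) ζ))

lemma weylInner_superposition {h : ℝ} (hh : h ≠ 0) {K : Frequency n → ℂ} (hK : Continuous K)
    (hK' : Integrable K) {b : PhaseSpace n → ℂ} {u : Config n → ℂ}
    (hb : Nice 0 b) (hu : Nice (configOrder n) u) (x θ : Config n) :
    weylInner h (superposition h K b) u x θ = ∫ ζ, K ζ * (shiftPhase h ζ x *
      weylInner h b u (x + (2 * Real.pi * h) • ζ.snd) (θ - (Real.pi * h) • ζ.fst)) := by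
  obtain ⟨cf, cs⟩ := continuous_fst_snd (n := n)
  obtain ⟨M, hM, hbM⟩ := hb.bound 0
  have e (y : Config n) : Complex.exp (Complex.I * ((inner ℝ (x - y) θ / h : ℝ) : ℂ)) *
        superposition h K b ((2⁻¹ : ℝ) • (x + y), θ) * u y =
      ∫ ζ, K ζ * (Complex.exp (Complex.I * ((inner ℝ (x - y) θ / h : ℝ) : ℂ)) *
        (planeWave ζ ((2⁻¹ : ℝ) • (x + y), θ) *
          b (((2⁻¹ : ℝ) • (x + y), θ) + (h • symplecticMap n) ζ)) * u y) := by
    rw [superposition, ← integral_const_mul, ← integral_mul_const]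
    exact integral_congr_ae (Eventually.of_forall fun ζ => by ring)
  rw [weylInner]
  simp only [e]
  rw [integral_integral_swap]
  · refine integral_congr_ae (Eventually.of_forall fun ζ => ?_)
    simp only [weylIntegrand_planeWave hh]
    rw [integral_const_mul, integral_const_mul, weylInner]
  · refine ((hu.integrable.norm.const_mul M).mul_prod hK'.norm).mono' ?_
      (Eventually.of_forall fun p => ?_)
    · refine Continuous.aestronglyMeasurable ?_
      have := hb.continuous
      have := hu.continuous
      unfold Function.uncurry planeWave
      simp only [div_eq_mul_inv]
      fun_prop
    · simp only [Function.uncurry, norm_mul, Complex.norm_exp_I_mul_ofReal, norm_planeWave,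
        one_mul]
      have := hbM.norm_le (((2⁻¹ : ℝ) • (x + p.1), θ) + (h • symplecticMap n) p.2)
      calc _ = ‖b (((2⁻¹ : ℝ) • (x + p.1), θ) + (h • symplecticMap n) p.2)‖ * ‖u p.1‖ * ‖K p.2‖ :=
            by ring
        _ ≤ _ := by gcongr

/-- After Fubini the shift of θ disappears by translation invariance, leaving the Heisenberg
translation with frequency ζ applied to `weyl h b u`. -/
lemma weyl_superposition {h : ℝ} (hh : 0 < h) {K : Frequency n → ℂ} (hK : Continuous K)
    (hK' : Integrable K) {b : PhaseSpace n → ℂ} {u : Config n → ℂ}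
    (hb : Nice 0 b) (hu : Nice (configOrder n) u) (x : Config n) :
    weyl h (superposition h K b) u x = ∫ ζ, K ζ * (shiftPhase h ζ x *
      weyl h b u (x + (2 * Real.pi * h) • ζ.snd)) := by
  obtain ⟨cf, cs⟩ := continuous_fst_snd (n := n)
  obtain ⟨C, hC, hI⟩ := exists_norm_weylInner_le n hh
  obtain ⟨M, hM, hbb⟩ := hb.bound (configOrder n)
  obtain ⟨M', hM', hbu⟩ := hu.2 (configOrder n)
  have hI := hI b u M M' hb hu hbb hbu
  set D : ℝ := C * M * M'
  have hD : 0 ≤ D := by positivity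
  set Y : Config n → Frequency n → ℂ := fun θ ζ => K ζ * (shiftPhase h ζ x *
      weylInner h b u (x + (2 * Real.pi * h) • ζ.snd) (θ - (Real.pi * h) • ζ.fst)) with hY
  have hYc : Continuous (Function.uncurry Y) := by
    have c1 : Continuous fun p : Config n × Frequency n =>
        weylInner h b u (x + (2 * Real.pi * h) • p.2.snd) (p.1 - (Real.pi * h) • p.2.fst) :=
      Continuous.comp (g := fun p : Config n × Config n => weylInner h b u p.1 p.2)
        (f := fun p : Config n × Frequency n =>
          (x + (2 * Real.pi * h) • p.2.snd, p.1 - (Real.pi * h) • p.2.fst))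
        (continuous_weylInner h hb hu) (by fun_prop)
    simp only [hY, shiftPhase, Function.uncurry_def]
    fun_prop
  have hYn (θ : Config n) (ζ : Frequency n) :
      ‖Y θ ζ‖ ≤ ‖K ζ‖ * (D * decay (configOrder n) (θ - (Real.pi * h) • ζ.fst)) := by
    simp only [hY, norm_mul, norm_shiftPhase, one_mul]
    gcongr
    exact hI _ _
  have hslice (ζ : Frequency n) : Integrable fun θ : Config n =>
      ‖K ζ‖ * (D * decay (configOrder n) (θ - (Real.pi * h) • ζ.fst)) :=
    (((integrable_decay volume).comp_sub_right _).const_mul D).const_mul _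
  have hYs (ζ : Frequency n) : Integrable fun θ => Y θ ζ :=
    (hslice ζ).mono' (hYc.comp (by fun_prop : Continuous fun θ : Config n =>
      (θ, ζ))).aestronglyMeasurable (Eventually.of_forall fun θ => hYn θ ζ)
  -- The majorant is not a product of functions of θ and ζ, so integrability is checked slice by
  -- slice; every θ-slice of the weight has the same integral.
  have hint : Integrable (Function.uncurry Y) (volume.prod volume) := by
    rw [integrable_prod_iff' hYc.aestronglyMeasurable]
    refine ⟨Eventually.of_forall hYs, ?_⟩
    refine (hK'.norm.mul_const (D * ∫ θ : Config n, decay (configOrder n) θ)).mono'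
      (hYc.norm.stronglyMeasurable.integral_prod_left').aestronglyMeasurable
      (Eventually.of_forall fun ζ => ?_)
    rw [Real.norm_of_nonneg (integral_nonneg fun _ => norm_nonneg _)]
    refine (integral_mono (hYs ζ).norm (hslice ζ) fun θ => hYn θ ζ).trans (le_of_eq ?_)
    rw [integral_const_mul, integral_const_mul,
      integral_sub_right_eq_self (fun θ : Config n => decay (configOrder n) θ)]
  rw [weyl_eq]
  simp only [weylInner_superposition hh.ne' hK hK' hb hu]
  rw [integral_integral_swap hint, ← integral_const_mul]
  refine integral_congr_ae (Eventually.of_forall fun ζ => ?_)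
  simp only [weyl_eq]
  rw [integral_const_mul, integral_const_mul,
    integral_sub_right_eq_self (fun θ => weylInner h b u (x + (2 * Real.pi * h) • ζ.snd) θ)]
  ring

/-- Fourier inversion after rescaling θ by 2πh; the Jacobian cancels the normalization. -/
lemma weyl_one {h : ℝ} (hh : 0 < h) {v : Config n → ℂ} (hv : Rapid v) (x : Config n) :
    weyl h (fun _ => 1) v x = v x := by
  have hc : (2 * Real.pi * h)⁻¹ ≠ 0 := by positivity
  have e (θ : Config n) : weylInner h (fun _ => 1) v x θ =
      (fun ξ : Config n => Complex.exp (((2 * Real.pi * inner ℝ ξ x : ℝ) : ℂ) * Complex.I) •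
        𝓕 v ξ) ((2 * Real.pi * h)⁻¹ • θ) := by
    rw [weylInner_eq_fourier]
    simp only [one_mul, smul_eq_mul]
    congr 2
    rw [inner_smul_left, real_inner_comm]
    simp only [conj_trivial]
    have : (h : ℂ) ≠ 0 := by exact_mod_cast hh.ne'
    have : (Real.pi : ℂ) ≠ 0 := by exact_mod_cast Real.pi_ne_zero
    push_cast
    field_simp
  rw [weyl_eq]
  simp only [e]
  rw [Measure.integral_comp_smul volume (fun ξ : Config n =>
    Complex.exp (((2 * Real.pi * inner ℝ ξ x : ℝ) : ℂ) * Complex.I) • 𝓕 v ξ),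
    ← Real.fourierInv_eq', hv.fourierInv_fourier, finrank_euclideanSpace_fin,
    Complex.real_smul, ← mul_assoc, ← Complex.ofReal_mul, inv_pow, inv_inv, abs_of_nonneg
    (by positivity), inv_mul_cancel₀ (by positivity)]
  simp

lemma inner_frequency (ζ η : Frequency n) :
    (inner ℝ ζ η : ℝ) = inner ℝ ζ.fst η.fst + inner ℝ ζ.snd η.snd :=
  WithLp.prod_inner_apply ζ η

lemma rapid_comp_toPhase {a : PhaseSpace n → ℂ} (ha : ContDiff ℝ ∞ a) (hs : HasCompactSupport a) :
    Rapid (fun w => a (toPhase n w)) := by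
  refine HasCompactSupport.rapid ?_ (ha.comp (toPhase n).contDiff)
  exact hs.comp_homeomorph
    (WithLp.prodContinuousLinearEquiv 2 ℝ (Config n) (Config n)).toHomeomorph

/-- For compactly supported `a` the pairing is an absolutely convergent integral, and translating
`a` by z multiplies its transform by the plane wave at z. -/
lemma star_eq_superposition {a b : PhaseSpace n → ℂ} (ha : ContDiff ℝ ∞ a)
    (hs : HasCompactSupport a) (hb : Nice 0 b) (h : ℝ) :
    star h a b = superposition h (𝓕 fun w => a (toPhase n w)) b := by
  funext z
  set η : Frequency n := WithLp.toLp 2 z with hη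
  have hη' : toPhase n η = z := rfl
  have e : (fun w => a (toPhase n w + z)) = fun w => a (toPhase n (w + η)) := by
    funext w
    rw [map_add, hη']
  have hr := rapid_comp_toPhase ha hs
  simp only [star, BoundedForm.translated, starForm, ContinuousLinearMap.id_apply, superposition]
  rw [pairing_eq_integral ((hb.translate z).comp_clm (h • symplecticMap n)).linearGrowth
    (by rw [e]; exact hr.translate η)]
  refine integral_congr_ae (Eventually.of_forall fun ζ => ?_)
  simp only [e]
  have : 𝓕 (fun w => a (toPhase n (w + η))) ζ =
      planeWave ζ z * 𝓕 (fun w => a (toPhase n w)) ζ := by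
    rw [Real.fourier_eq', Real.fourier_eq', ← integral_const_mul,
      ← integral_add_right_eq_self (fun w : Frequency n => _ * _) η]
    refine integral_congr_ae (Eventually.of_forall fun w => ?_)
    simp only [smul_eq_mul]
    rw [← mul_assoc, planeWave, ← Complex.exp_add]
    congr 2
    rw [inner_add_left, inner_frequency η ζ, real_inner_comm ζ.fst η.fst,
      real_inner_comm ζ.snd η.snd]
    have e1 : η.fst = z.1 := rfl
    have e2 : η.snd = z.2 := rfl
    rw [e1, e2]
    push_cast
    ring
  rw [this, add_comm z]
  ring

lemma superposition_one {a : PhaseSpace n → ℂ} (ha : ContDiff ℝ ∞ a)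
    (hs : HasCompactSupport a) (h : ℝ) :
    superposition h (𝓕 fun w => a (toPhase n w)) (fun _ => 1) = a := by
  funext z
  have hr := rapid_comp_toPhase ha hs
  have := congrFun hr.fourierInv_fourier (WithLp.toLp 2 z)
  rw [Real.fourierInv_eq'] at this
  refine Eq.trans ?_ this
  refine integral_congr_ae (Eventually.of_forall fun ζ => ?_)
  simp only [smul_eq_mul, mul_one, planeWave]
  rw [mul_comm, inner_frequency, mul_comm Complex.I]
  rfl

/-- Both sides equal the same superposition of Heisenberg translations of `weyl h b u`: on the left
with second symbol `b` acting on `u`, on the right with second symbol 1 acting on `weyl h b u`. -/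
lemma weyl_star_of_hasCompactSupport {h : ℝ} (hh : 0 < h) {a b : PhaseSpace n → ℂ}
    (ha : ContDiff ℝ ∞ a) (hs : HasCompactSupport a) (hb : Nice 0 b) {u : Config n → ℂ}
    (hu : Rapid u) (x : Config n) :
    weyl h (star h a b) u x = weyl h a (weyl h b u) x := by
  have hr := (rapid_comp_toPhase ha hs).fourier
  have hv := hu.weyl hh hb
  rw [star_eq_superposition ha hs hb,
    weyl_superposition hh (hr 0).continuous hr.integrable hb (hu (configOrder n))]
  conv_rhs => rw [← superposition_one ha hs h]
  rw [weyl_superposition hh (hr 0).continuous hr.integrable (Nice.const 1) (hv (configOrder n))]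
  simp only [weyl_one hh hv]

end Superposition

/-! ### Removing the compact support -/

section Composition

open Filter Topology Module

variable {n : ℕ}

/-- A smooth compactly supported function equal to one on the unit ball, dilated by `j + 1`. -/
noncomputable def cutoff (j : ℕ) (z : PhaseSpace n) : ℂ :=
  ((default : ContDiffBump (0 : PhaseSpace n))
    ((((j : ℝ) + 1)⁻¹ • ContinuousLinearMap.id ℝ (PhaseSpace n)) z) : ℝ)

lemma contDiff_bump : ContDiff ℝ ∞
    fun z : PhaseSpace n => (((default : ContDiffBump (0 : PhaseSpace n)) z : ℝ) : ℂ) :=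
  Complex.ofRealCLM.contDiff.comp (default : ContDiffBump (0 : PhaseSpace n)).contDiff

lemma nice_bump : Nice 0
    fun z : PhaseSpace n => (((default : ContDiffBump (0 : PhaseSpace n)) z : ℝ) : ℂ) :=
  HasCompactSupport.rapid ((default : ContDiffBump (0 : PhaseSpace n)).hasCompactSupport.comp_left
    (g := fun t : ℝ => (t : ℂ)) (by simp)) contDiff_bump 0

lemma nice_cutoff (j : ℕ) : Nice 0 (cutoff j : PhaseSpace n → ℂ) :=
  nice_bump.comp_clm (((j : ℝ) + 1)⁻¹ • ContinuousLinearMap.id ℝ (PhaseSpace n))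

lemma hasCompactSupport_cutoff (j : ℕ) : HasCompactSupport (cutoff j : PhaseSpace n → ℂ) := by
  have h : ((j : ℝ) + 1)⁻¹ ≠ 0 := by positivity
  exact ((default : ContDiffBump (0 : PhaseSpace n)).hasCompactSupport.comp_left
    (g := fun t : ℝ => (t : ℂ)) (by simp)).comp_homeomorph (Homeomorph.smulOfNeZero _ h)

/-- Cutoffs only get flatter as `j` grows: the dilation has norm at most one, so composing with it
does not increase derivatives. -/
lemma exists_hasBound_cutoff (n N : ℕ) : ∃ M : ℝ, 0 ≤ M ∧
    ∀ j, HasBound N (fun _ => M) (cutoff j : PhaseSpace n → ℂ) := by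
  obtain ⟨M, hM, h⟩ := nice_bump (n := n).bound N
  refine ⟨M, hM, fun j => ?_⟩
  refine (h.comp_clm contDiff_bump
    (((j : ℝ) + 1)⁻¹ • ContinuousLinearMap.id ℝ (PhaseSpace n))).mono le_rfl fun _ => ?_
  have : ‖((j : ℝ) + 1)⁻¹ • ContinuousLinearMap.id ℝ (PhaseSpace n)‖ ≤ 1 := by
    rw [norm_smul]
    refine mul_le_one₀ ?_ (norm_nonneg _) ContinuousLinearMap.norm_id_le
    rw [Real.norm_of_nonneg (by positivity)]
    exact inv_le_one_of_one_le₀ (by linarith [Nat.cast_nonneg (α := ℝ) j])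
  rw [max_eq_left this, one_pow, one_mul]

lemma eventually_cutoff_eq_one (R : ℝ) :
    ∀ᶠ j in atTop, ∀ z : PhaseSpace n, ‖z‖ ≤ R → cutoff j z = 1 := by
  filter_upwards [eventually_ge_atTop ⌈R⌉₊] with j hj z hz
  have h1 : ‖z‖ ≤ (j : ℝ) + 1 := by
    have := Nat.le_of_ceil_le hj
    linarith
  rw [cutoff, ContDiffBump.one_of_mem_closedBall]
  · simp
  · change _ ∈ Metric.closedBall (0 : PhaseSpace n) 1
    rw [mem_closedBall_zero_iff, smul_apply, ContinuousLinearMap.id_apply, norm_smul,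
      Real.norm_of_nonneg (by positivity), inv_mul_le_iff₀ (by positivity), mul_one]
    exact h1

lemma exists_hasBound_cutoff_mul {a : PhaseSpace n → ℂ} (ha : Nice 0 a) (N : ℕ) :
    ∃ M : ℝ, 0 ≤ M ∧ ∀ j, HasBound N (fun _ => M) (fun z => cutoff j z * a z) := by
  obtain ⟨M, hM, h⟩ := exists_hasBound_cutoff n N
  obtain ⟨M', hM', h'⟩ := ha.bound N
  exact ⟨2 ^ N * M * M', by positivity, fun j => (h j).mul (nice_cutoff j).1 ha.1 h'⟩

lemma nice_star {h : ℝ} (h0 : 0 ≤ h) (h1 : h ≤ 1) {a b : PhaseSpace n → ℂ} (ha : Nice 0 a)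
    (hb : Nice 0 b) : Nice 0 (star h a b) := by
  refine ⟨contDiff_star h0 h1 ha hb, fun P => ?_⟩
  obtain ⟨K, hK, hT⟩ := LeibnizProduct.exists_hasBound (starConst_nonneg n) n (starOrder n) P
  obtain ⟨M, hM, hbM⟩ := ha.bound (starOrder n + P)
  obtain ⟨M', hM', hbM'⟩ := hb.bound (starOrder n + P)
  exact ⟨K * M * M', by positivity, by
    simpa using hT _ _ _ _ _ (leibnizProduct_star h0 h1) ha hb hbM hbM'⟩

lemma tendsto_star_cutoff_mul {a b : PhaseSpace n → ℂ} (ha : Nice 0 a) (hb : Nice 0 b)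
    (h : ℝ) (z : PhaseSpace n) :
    Tendsto (fun j => star h (fun w => cutoff j w * a w) b z) atTop (𝓝 (star h a b z)) := by
  obtain ⟨M, hM, hbM⟩ := exists_hasBound_cutoff_mul ha (starOrder n)
  have nj (j : ℕ) : Nice 0 fun w => cutoff j w * a w := (nice_cutoff j).mul ha
  simp only [star, BoundedForm.translated, starForm, ContinuousLinearMap.id_apply]
  refine tendsto_pairing ((hb.translate z).comp_clm (h • symplecticMap n)).linearGrowth
    (A := fun j w => cutoff j (toPhase n w + z) * a (toPhase n w + z))
    (fun j => ((nj j).translate z).comp_clm (toPhase n))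
    (fun j => ((hbM j).translate z).comp_clm ((nj j).translate z).1 (toPhase n)) fun R => ?_
  filter_upwards [eventually_cutoff_eq_one (n := n) (‖toPhase n‖ * R + ‖z‖)] with j hj w hw
  rw [hj, one_mul]
  refine (norm_add_le _ _).trans ?_
  gcongr
  exact ((toPhase n).le_opNorm w).trans (by gcongr)

/-- The first symbol is approximated by its cutoffs and both sides pass to the limit. On the left
this needs `configOrder n` derivatives of the products a_j ⋆ b bounded uniformly in `j`, hence the
order `starOrder n + configOrder n` on the factors. -/
lemma weyl_star {h : ℝ} (h0 : 0 < h) (h1 : h ≤ 1) {a b : PhaseSpace n → ℂ}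
    (ha : Nice 0 a) (hb : Nice 0 b) {u : Config n → ℂ} (hu : Rapid u) (x : Config n) :
    weyl h (star h a b) u x = weyl h a (weyl h b u) x := by
  have nj (j : ℕ) : Nice 0 fun w => cutoff j w * a w := (nice_cutoff j).mul ha
  obtain ⟨K, hK, hT⟩ := LeibnizProduct.exists_hasBound (starConst_nonneg n) n (starOrder n)
    (configOrder n)
  obtain ⟨M, hM, hbM⟩ := exists_hasBound_cutoff_mul ha (starOrder n + configOrder n)
  obtain ⟨M', hM', hbM'⟩ := hb.bound (starOrder n + configOrder n)
  have l1 := tendsto_weyl h0 (A := fun j => star h (fun w => cutoff j w * a w) b)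
    (fun j => nice_star h0.le h1 (nj j) hb) (hu (configOrder n))
    (fun j => hT _ _ _ _ _ (leibnizProduct_star h0.le h1) (nj j) hb (hbM j) hbM')
    (tendsto_star_cutoff_mul ha hb h) x
  have l2 := tendsto_weyl h0 (a := a) nj (hu.weyl h0 hb (configOrder n))
    (fun j => (hbM j).mono (Nat.le_add_left _ _) fun _ => le_rfl) (fun z => by
      refine tendsto_const_nhds.congr' ?_
      filter_upwards [eventually_cutoff_eq_one (n := n) ‖z‖] with j hj
      rw [hj z le_rfl, one_mul]) x
  refine tendsto_nhds_unique (l1.congr fun j => ?_) l2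
  exact weyl_star_of_hasCompactSupport h0 (nj j).1 (hasCompactSupport_cutoff j).mul_right hb hu x

lemma IsGevrey.exists_listGevrey {s : ℝ} {a : PhaseSpace n → ℂ} (ha : IsGevrey s a) :
    ∃ C : ℝ, 1 ≤ C ∧ ListGevrey s C a := by
  obtain ⟨C, hC, h⟩ := ha
  exact ⟨max C 1, le_max_right _ _, (gevreyBound_iff_listGevrey.1 h).mono hC.le (le_max_left _ _)⟩

lemma isGevreySymbol_of_leibnizProduct {s K : ℝ} (hs : 0 ≤ s) (hK : 0 ≤ K) {N : ℕ}
    {T : ℝ → (PhaseSpace n → ℂ) → (PhaseSpace n → ℂ) → PhaseSpace n → ℂ}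
    (hT : ∀ h ∈ Set.Ioc (0 : ℝ) 1, LeibnizProduct K N (T h)) {a b : PhaseSpace n → ℂ}
    (ha : IsGevrey s a) (hb : IsGevrey s b) : IsGevreySymbol s fun h => T h a b := by
  obtain ⟨C, hC, ga⟩ := ha.exists_listGevrey
  obtain ⟨C', hC', gb⟩ := hb.exists_listGevrey
  obtain ⟨D, hD, h⟩ := LeibnizProduct.exists_listGevrey hs (hC.trans (le_max_left C C')) hK n N
  exact ⟨D, hD, fun t ht => gevreyBound_iff_listGevrey.2 (h _ _ _ (hT t ht)
    (ga.mono (by linarith) (le_max_left _ _)) (gb.mono (by linarith) (le_max_right _ _)))⟩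

lemma IsGevrey.nice {s : ℝ} (hs : 0 ≤ s) {a : PhaseSpace n → ℂ} (ha : IsGevrey s a) : Nice 0 a :=
  have ⟨_, hC, h⟩ := ha
  (gevreyBound_iff_listGevrey.1 h).nice hs hC.le

lemma eq_of_weyl_eq {h : ℝ} (hh : 0 < h) {c d : PhaseSpace n → ℂ} (hc : Nice 0 c)
    (hd : Nice 0 d) (e : ∀ (u : 𝓢(Config n, ℂ)) (x : Config n), weyl h c u x = weyl h d u x) :
    c = d := by
  funext z
  have hd' := hd.const_mul (-1)
  have := eq_zero_of_weyl_eq_zero hh (hc.add hd') (fun u x => by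
    rw [weyl_add_left hh hc hd' (u.rapid (configOrder n)), weyl_smul_left, e]
    ring) z
  linear_combination this

end Composition

end GevreyWeyl

/-! ### The proposition -/

theorem proposition2p3 (n : ℕ) (s : ℝ) (hs : 1 < s)
    (a b : GevreyWeyl.PhaseSpace n → ℂ)
    (ha : GevreyWeyl.IsGevrey s a) (hb : GevreyWeyl.IsGevrey s b) :
    (∃ c : ℝ → GevreyWeyl.PhaseSpace n → ℂ,
      GevreyWeyl.IsGevreySymbol s c ∧ GevreyWeyl.IsComposedSymbol a b c) ∧
    ∀ c : ℝ → GevreyWeyl.PhaseSpace n → ℂ,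
      (∀ h ∈ Set.Ioc (0 : ℝ) 1, GevreyWeyl.IsGevrey s (c h)) →
      GevreyWeyl.IsComposedSymbol a b c →
      ∃ r : ℝ → GevreyWeyl.PhaseSpace n → ℂ,
        GevreyWeyl.IsGevreySymbol s r ∧
        ∀ h ∈ Set.Ioc (0 : ℝ) 1, ∀ p : GevreyWeyl.PhaseSpace n,
          c h p = a p * b p + (h : ℂ) * r h p := by
  have hs0 : 0 ≤ s := by linarith
  have na := ha.nice hs0
  have nb := hb.nice hs0
  have hcomp (h : ℝ) (hh : h ∈ Set.Ioc (0 : ℝ) 1)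
      (u : 𝓢(GevreyWeyl.Config n, ℂ)) (x : GevreyWeyl.Config n) :=
    GevreyWeyl.weyl_star hh.1 hh.2 na nb u.rapid x
  refine ⟨⟨fun h => GevreyWeyl.star h a b,
    GevreyWeyl.isGevreySymbol_of_leibnizProduct hs0 (GevreyWeyl.starConst_nonneg n)
      (fun h hh => GevreyWeyl.leibnizProduct_star hh.1.le hh.2) ha hb,
    fun h hh u => funext (hcomp h hh u)⟩, fun c hc hcab => ⟨fun h =>
    GevreyWeyl.starRemainder h a b,
    GevreyWeyl.isGevreySymbol_of_leibnizProduct hs0 (GevreyWeyl.starConst_nonneg n)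
      (fun h hh => GevreyWeyl.leibnizProduct_starRemainder hh.1 hh.2) ha hb, fun h hh p => ?_⟩⟩
  -- Injectivity leaves no freedom in `c`: it is the Moyal product, so a single uniformly Gevrey
  -- remainder serves every admissible family.
  have e : c h = GevreyWeyl.star h a b := GevreyWeyl.eq_of_weyl_eq hh.1 ((hc h hh).nice hs0)
    (GevreyWeyl.nice_star hh.1.le hh.2 na nb)
    fun u x => (congrFun (hcab h hh u) x).trans (hcomp h hh u x).symm
  have h0 : (h : ℂ) ≠ 0 := by exact_mod_cast hh.1.ne'
  simp only [e, GevreyWeyl.starRemainder, mul_inv_cancel_left₀ h0]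
  ring
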